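/- Let $K$ be a field of characteristic $0$ and $R=K[x_1,\dots,x_n]$, with the standard grading and the (graded) reverse lexicographic order with $x_1>\dots>x_n$. For a homogeneous ideal $J\subseteq R$ let $\mathrm{gin}(J)$ be its reverse lexicographic generic initial ideal, i.e. the ideal with $\mathrm{in}(g\cdot J)=\mathrm{gin}(J)$ for all $g$ in a nonempty Zariski open subset of $GL_n(K)$, where $g$ acts by linear change of coordinates. Let $J\subseteq R$ be a nonzero homogeneous ideal such that $\mathrm{gin}(J)$ is generated in (at most) two variables, i.e. $\mathrm{gin}(J)$ has a generating set whose elements involve only variables from a set of at most two of the variables $x_1,\dots,x_n$. Let $\alpha$ be the smallest degree of an element of a minimal system of homogeneous generators of $J$. If $$\alpha=\#\{\text{minimal generators of }J\}-1,$$ then $J$ is componentwise linear: for every $k\ge 0$ the ideal $(J_k)$ generated by all homogeneous polynomials of degree $k$ in $J$ has a $k$-linear resolution, i.e. there is an exact sequence of graded $R$-modules $$0\to R(-k-s)^{\beta_s}\to\cdots\to R(-k-1)^{\beta_1}\to R(-k)^{\beta_0}\to (J_k)\to 0$$ (where the zero ideal has the zero resolution). -/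

import Mathlib

/-! Generic initial ideals for the (graded) reverse lexicographic order, minimal homogeneous
generating sets, linear resolutions and componentwise linear ideals, in the polynomial ring
`K[x₁, …, xₙ] = MvPolynomial (Fin n) K`; the variable `xᵢ₊₁` is `MvPolynomial.X i`. -/

attribute [local instance] MvPolynomial.gradedAlgebra

/-! ### The graded reverse lexicographic order -/

/-- Exponent vectors, a type synonym carrying the graded reverse lexicographic order. -/
def DegRevLex (n : ℕ) : Type := Fin n →₀ ℕ

namespace DegRevLex

noncomputable instance (n : ℕ) : AddCommMonoid (DegRevLex n) :=
  inferInstanceAs (AddCommMonoid (Fin n →₀ ℕ))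

/-- The identity, from exponent vectors to the type synonym. -/
def of (n : ℕ) : (Fin n →₀ ℕ) ≃+ DegRevLex n where
  toFun a := a
  invFun a := a
  left_inv _ := rfl
  right_inv _ := rfl
  map_add' _ _ := rfl

/-- The comparison key of `a = (a₁, …, aₙ)`: first the total degree, then the exponents
`aₙ, aₙ₋₁, …, a₁` read lexicographically, where a *smaller* exponent counts as *larger*. -/
noncomputable def key (n : ℕ) (a : DegRevLex n) : ℕ ×ₗ Lex (Fin n → ℕᵒᵈ) :=
  toLex (((of n).symm a).degree, toLex fun i : Fin n => OrderDual.toDual ((of n).symm a i.rev))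

theorem key_injective (n : ℕ) : Function.Injective (key n) := by
  intro a b h
  have h2 := congrArg (fun p => ofLex (ofLex p).2) h
  refine (of n).symm.injective (Finsupp.ext fun i => ?_)
  have h3 := congrFun h2 i.rev
  simpa [key] using h3

noncomputable instance (n : ℕ) : LinearOrder (DegRevLex n) :=
  LinearOrder.lift' (key n) (key_injective n)

/-- The textbook description: `a < b` iff `|a| < |b|`, or `|a| = |b|` and `bᵢ < aᵢ` at the last
index `i` at which `a` and `b` differ. -/
theorem of_lt_of_iff {n : ℕ} (a b : Fin n →₀ ℕ) :
    of n a < of n b ↔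
      a.degree < b.degree ∨ (a.degree = b.degree ∧ ∃ i, (∀ j, i < j → a j = b j) ∧ b i < a i) := by
  have h0 : of n a < of n b ↔ key n (of n a) < key n (of n b) := Iff.rfl
  rw [h0]
  unfold key
  rw [Prod.Lex.toLex_lt_toLex, AddEquiv.symm_apply_apply, AddEquiv.symm_apply_apply]
  refine or_congr Iff.rfl (and_congr Iff.rfl ?_)
  constructor
  · rintro ⟨i, h1, h2⟩
    refine ⟨i.rev, fun j hj => ?_, h2⟩
    have := h1 j.rev (show j.rev < i by rw [← Fin.rev_lt_rev, Fin.rev_rev]; exact hj)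
    simpa using this
  · rintro ⟨i, h1, h2⟩
    refine ⟨i.rev, fun j hj => ?_, ?_⟩
    · have := h1 j.rev (by rw [← Fin.rev_lt_rev, Fin.rev_rev]; exact hj)
      simp [this]
    · have : OrderDual.toDual (a i.rev.rev) < OrderDual.toDual (b i.rev.rev) := by
        rw [Fin.rev_rev]; exact h2
      exact this

theorem of_add_lt_of_add {n : ℕ} (a b c : Fin n →₀ ℕ) (h : of n a < of n b) :
    of n (a + c) < of n (b + c) := by
  rw [of_lt_of_iff] at h ⊢
  simp only [map_add, Finsupp.add_apply, add_lt_add_iff_right, add_left_inj]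
  exact h

instance (n : ℕ) : IsOrderedAddMonoid (DegRevLex n) where
  add_le_add_left a b h c := by
    rcases h.eq_or_lt with h | h
    · rw [h]
    · exact (of_add_lt_of_add (n := n) a b c h).le

theorem of_monotone (n : ℕ) : Monotone (of n) := by
  intro a b h
  rcases h.eq_or_lt with h | h
  · rw [h]
  · refine ((of_lt_of_iff a b).2 (Or.inl ?_)).le
    obtain ⟨c, rfl⟩ := le_iff_exists_add.1 h.le
    have hc : c ≠ 0 := by
      rintro rfl
      simp at h
    rw [map_add]
    have : c.degree ≠ 0 := fun h0 => hc ((Finsupp.degree_eq_zero_iff c).1 h0)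
    omega

instance (n : ℕ) : WellFoundedLT (DegRevLex n) := by
  have h : WellQuasiOrderedLE (Fin n →₀ ℕ) := inferInstance
  have : WellQuasiOrderedLE (DegRevLex n) := by
    refine ⟨fun f => ?_⟩
    obtain ⟨i, j, hij, hle⟩ := h.wqo (fun k => (of n).symm (f k))
    exact ⟨i, j, hij, of_monotone n hle⟩
  infer_instance

end DegRevLex

/-- The graded reverse lexicographic monomial order on `K[x₁, …, xₙ]` with `x₁ > ⋯ > xₙ`. -/
noncomputable def degRevLex (n : ℕ) : MonomialOrder (Fin n) where
  syn := DegRevLex n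
  toSyn := DegRevLex.of n
  toSyn_monotone := DegRevLex.of_monotone n

/-! ### Initial ideals and generic initial ideals -/

open MvPolynomial in
/-- The initial ideal `in(I)`: generated by the leading terms of the elements of `I`. -/
noncomputable def initialIdeal {σ K : Type*} [Field K] (m : MonomialOrder σ)
    (I : Ideal (MvPolynomial σ K)) : Ideal (MvPolynomial σ K) :=
  Ideal.span (m.leadingTerm '' (I : Set (MvPolynomial σ K)))

/-- The linear change of coordinates `xⱼ ↦ ∑ᵢ gᵢⱼ xᵢ`. -/
noncomputable def linearChange {K : Type*} [Field K] {n : ℕ} (g : Matrix (Fin n) (Fin n) K) :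
    MvPolynomial (Fin n) K →ₐ[K] MvPolynomial (Fin n) K :=
  MvPolynomial.aeval fun j => ∑ i, MvPolynomial.C (g i j) * MvPolynomial.X i

/-- `G` is the reverse lexicographic generic initial ideal `gin(J)`: `in(g J) = G` for all `g` in
a nonempty Zariski open subset of `GLₙ(K)`. Such a subset can be shrunk to a basic open set, the
set where a nonzero polynomial `P` in the `n²` matrix entries does not vanish. (This is for
infinite `K`, where every nonzero `P` is nonzero at some invertible matrix.) -/
def IsGenericInitialIdeal {K : Type*} [Field K] {n : ℕ}
    (J G : Ideal (MvPolynomial (Fin n) K)) : Prop :=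
  ∃ P : MvPolynomial (Fin n × Fin n) K, P ≠ 0 ∧
    ∀ g : GL (Fin n) K, MvPolynomial.eval (fun p : Fin n × Fin n => g.val p.1 p.2) P ≠ 0 →
      initialIdeal (degRevLex n) (J.map (linearChange g.val)) = G

/-- The generic initial ideal is unique. -/
theorem IsGenericInitialIdeal.unique {K : Type*} [Field K] [Infinite K] {n : ℕ}
    {J G G' : Ideal (MvPolynomial (Fin n) K)}
    (h : IsGenericInitialIdeal J G) (h' : IsGenericInitialIdeal J G') : G = G' := by
  obtain ⟨P, hP, h⟩ := h
  obtain ⟨Q, hQ, h'⟩ := h'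
  have hD : (Matrix.mvPolynomialX (Fin n) (Fin n) K).det ≠ 0 :=
    Matrix.det_mvPolynomialX_ne_zero (Fin n) K
  have hne : P * Q * (Matrix.mvPolynomialX (Fin n) (Fin n) K).det ≠ 0 :=
    mul_ne_zero (mul_ne_zero hP hQ) hD
  obtain ⟨v, hv⟩ : ∃ v, MvPolynomial.eval v
      (P * Q * (Matrix.mvPolynomialX (Fin n) (Fin n) K).det) ≠ 0 := by
    by_contra! hcon
    exact hne (MvPolynomial.funext fun v => by rw [hcon v, map_zero])
  rw [map_mul, map_mul] at hv
  have hdet : (Matrix.of fun i j => v (i, j)).det ≠ 0 := by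
    intro h0
    refine hv ?_
    rw [RingHom.map_det]
    have : (MvPolynomial.eval v).mapMatrix (Matrix.mvPolynomialX (Fin n) (Fin n) K) =
        Matrix.of fun i j => v (i, j) := by
      ext i j
      simp [Matrix.mvPolynomialX]
    rw [this, h0, mul_zero]
  have hPv := left_ne_zero_of_mul (left_ne_zero_of_mul hv)
  have hQv := right_ne_zero_of_mul (left_ne_zero_of_mul hv)
  let g : GL (Fin n) K := Matrix.GeneralLinearGroup.mkOfDetNeZero _ hdet
  exact (h g hPv).symm.trans (h' g hQv)

/-- The ideal `G` is generated in (at most) two variables: it has a generating set consisting of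
polynomials that involve only variables from a set of at most two variables. -/
def IsGeneratedInTwoVariables {K : Type*} [Field K] {n : ℕ}
    (G : Ideal (MvPolynomial (Fin n) K)) : Prop :=
  ∃ V : Finset (Fin n), V.card ≤ 2 ∧
    ∃ T : Set (MvPolynomial (Fin n) K), (∀ f ∈ T, f.vars ⊆ V) ∧ Ideal.span T = G

/-! ### Minimal generators -/

/-- `S` is a minimal system of homogeneous generators of `J`. -/
structure IsMinimalHomogeneousGenerators {K : Type*} [Field K] {n : ℕ}
    (J : Ideal (MvPolynomial (Fin n) K)) (S : Finset (MvPolynomial (Fin n) K)) : Prop where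
  homogeneous : ∀ f ∈ S, ∃ d : ℕ, f.IsHomogeneous d
  span_eq : Ideal.span (S : Set (MvPolynomial (Fin n) K)) = J
  minimal : ∀ f ∈ S, f ∉ Ideal.span ((S : Set (MvPolynomial (Fin n) K)) \ {f})

/-! ### Linear resolutions and componentwise linearity -/

/-- The ideal `I` has a `d`-linear resolution: there is an exact sequence of graded modules
`0 → R(-d-s)^(β s) → ⋯ → R(-d-1)^(β 1) → R(-d)^(β 0) → I → 0`.
A homomorphism `R(-d)^(β 0) → I` of graded modules is given by `β 0` elements `ε j` of `I` that
are homogeneous of degree `d`, and a homomorphism `R(-d-i-1)^(β (i+1)) → R(-d-i)^(β i)` by a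
matrix `A i` of homogeneous polynomials of degree `1`; hence such a resolution is minimal. -/
def HasLinearResolution {K : Type*} [Field K] {n : ℕ} (d : ℕ)
    (I : Ideal (MvPolynomial (Fin n) K)) : Prop :=
  ∃ (s : ℕ) (β : ℕ → ℕ) (ε : Fin (β 0) → MvPolynomial (Fin n) K)
    (A : ∀ i : ℕ, Matrix (Fin (β i)) (Fin (β (i + 1))) (MvPolynomial (Fin n) K)),
    (∀ i, s < i → β i = 0) ∧
    (∀ j, (ε j).IsHomogeneous d) ∧
    (∀ i a b, (A i a b).IsHomogeneous 1) ∧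
    Ideal.span (Set.range ε) = I ∧
    Function.Exact (A 0).mulVecLin (Fintype.linearCombination (MvPolynomial (Fin n) K) ε) ∧
    ∀ i, Function.Exact (A (i + 1)).mulVecLin (A i).mulVecLin

/-- The ideal `(J_k)` generated by all homogeneous polynomials of degree `k` in `J`. -/
noncomputable def degreeComponentIdeal {K : Type*} [Field K] {n : ℕ}
    (J : Ideal (MvPolynomial (Fin n) K)) (k : ℕ) : Ideal (MvPolynomial (Fin n) K) :=
  Ideal.span {f | f ∈ J ∧ f.IsHomogeneous k}

/-- `J` is componentwise linear: every `(J_k)` has a linear resolution, necessarily a `k`-linear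
one since `(J_k)` is generated in degree `k` (the zero ideal has the zero resolution). -/
def IsComponentwiseLinear {K : Type*} [Field K] {n : ℕ}
    (J : Ideal (MvPolynomial (Fin n) K)) : Prop :=
  ∀ k : ℕ, HasLinearResolution k (degreeComponentIdeal J k)

/-! ### Linear free resolutions from Pommaret-type bases -/

section PommaretBasis

open MvPolynomial

/-! Write `R₁` for the linear forms and `J_d` for the forms of degree `d` in `J`. Let `f` be a
generator of degree `α`. The coefficient of `x₁^α` in `g·f` is the value of `f` at the first row of
`g`, so generic coordinates can be chosen in which `in(J) = gin(J)` contains `x₁^α`. The minimal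
monomial generators of `in(J)` then involve `x₁` and at most one other variable `x_b`. Two of them
with the same `x₁`-exponent would divide one another, and this exponent is at most `α`, so there are
at most `α + 1` of them (`card_minimalExponents_le`). Conversely, in each degree `J` has at most as
many minimal generators as `in(J)`. Since `J` has `α + 1`, all these inequalities are equalities,
with two consequences.

First, the leading monomials of `R₁ J_{d-1}` are exactly the products of a variable and a monomial
of degree `d - 1` in `in(J)` (`leadingExponents_linearMultiples_of_card_le`). Second, every
`x₁`-exponent from `0` to `α` occurs among the generators. The `x_b`-exponent has to drop whenever
the `x₁`-exponent rises, so `in(J)` is stable for a ranking with `x₁` first and `x_b` second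
(`exists_stable_ranking`). Thus stability comes from counting, not from Borel-fixedness.

Together these show that forms of degree `k` in `J` realizing each leading monomial once are a
Pommaret basis of `(J_k)`: every element is uniquely `∑ qⱼ hⱼ`, where `qⱼ` uses only variables
ranked no lower than the last variable of the leading monomial of `hⱼ`, as in the Eliahou–Kervaire
decomposition (`isComponentwiseLinear_of_stable`). The rewriting rules for the remaining products
`xᵢ hⱼ` are linear syzygies, which again form a Pommaret basis, with smaller classes
(`IsPommaretBasis.exists_syzygies`). Iteration gives a finite linear resolution, which is carried
back to the original coordinates. -/

theorem homogeneousComponent_mul_of_isHomogeneous {σ R : Type*} [CommSemiring R]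
    {f g : MvPolynomial σ R} {e : ℕ} (hg : g.IsHomogeneous e) (k : ℕ) :
    homogeneousComponent k (f * g) =
      if e ≤ k then homogeneousComponent (k - e) f * g else 0 := by
  have h (i : ℕ) : homogeneousComponent k (homogeneousComponent i f * g) =
      if i + e = k then homogeneousComponent i f * g else 0 := by
    rw [homogeneousComponent_of_mem ((homogeneousComponent_isHomogeneous i f).mul hg)]
    simp only [eq_comm]
  conv_lhs => rw [← sum_homogeneousComponent f, Finset.sum_mul, map_sum]
  simp only [h]
  split_ifs with hek
  · rw [Finset.sum_eq_single (k - e)]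
    · rw [if_pos (by omega)]
    · intro i _ hi
      rw [if_neg (by omega)]
    · intro hi
      rw [homogeneousComponent_eq_zero _ _ (by rw [Finset.mem_range] at hi; omega), zero_mul, ite_self]
  · exact Finset.sum_eq_zero fun i _ => if_neg (by omega)

/-- The exponent vectors involving only variables of rank at least `c`. -/
def tailExponents {σ : Type*} (ρ : σ → ℕ) (c : ℕ) : Set (σ →₀ ℕ) := {m | ∀ i, m i ≠ 0 → c ≤ ρ i}

/-- The polynomials involving only variables of rank at least `c`. -/
noncomputable def tailPolynomials {σ : Type*} (K : Type*) [Field K] (ρ : σ → ℕ) (c : ℕ) :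
    Submodule K (MvPolynomial σ K) :=
  restrictSupport K (tailExponents ρ c)

variable {σ K : Type*} [Field K] {ρ : σ → ℕ} {c : ℕ}

theorem mem_tailPolynomials {p : MvPolynomial σ K} :
    p ∈ tailPolynomials K ρ c ↔ ∀ m, coeff m p ≠ 0 → m ∈ tailExponents ρ c := by
  unfold tailPolynomials
  rw [mem_restrictSupport_iff]
  simp only [Set.subset_def, Finset.mem_coe, mem_support_iff]

theorem X_mem_tailPolynomials {i : σ} (h : c ≤ ρ i) : X i ∈ tailPolynomials K ρ c := by
  classical
  rw [mem_tailPolynomials]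
  intro m hm j hj
  rw [coeff_X] at hm
  obtain rfl : Finsupp.single i 1 = m := by by_contra h; simp [h] at hm
  obtain rfl : i = j := by by_contra h; simp [h] at hj
  exact h

theorem degreeOf_eq_zero_of_mem_tailPolynomials {p : MvPolynomial σ K}
    (hp : p ∈ tailPolynomials K ρ c) {i : σ} (hi : ρ i < c) : degreeOf i p = 0 := by
  classical
  rw [← Nat.le_zero, degreeOf_le_iff]
  intro m hm
  by_contra h
  exact absurd (mem_tailPolynomials.1 hp m (mem_support_iff.1 hm) i (by omega)) (by omega)

theorem homogeneousComponent_mem_tailPolynomials {p : MvPolynomial σ K}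
    (hp : p ∈ tailPolynomials K ρ c) (d : ℕ) :
    homogeneousComponent d p ∈ tailPolynomials K ρ c := by
  rw [mem_tailPolynomials] at hp ⊢
  intro m hm
  rw [coeff_homogeneousComponent] at hm
  exact hp m fun h => hm (by simp [h])

open Classical in
/-- The projection to the polynomials in the variables of rank at least `c`. -/
noncomputable def tailPart (ρ : σ → ℕ) (c : ℕ) (p : MvPolynomial σ K) : MvPolynomial σ K :=
  ∑ m ∈ p.support with m ∈ tailExponents ρ c, monomial m (coeff m p)

open Classical in
theorem coeff_tailPart (p : MvPolynomial σ K) (m : σ →₀ ℕ) :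
    coeff m (tailPart ρ c p) = if m ∈ tailExponents ρ c then coeff m p else 0 := by
  unfold tailPart
  simp only [coeff_sum, coeff_monomial, Finset.sum_ite_eq', Finset.mem_filter, mem_support_iff]
  by_cases h : coeff m p = 0 <;> simp [h]

/-- The part of `p` consisting of the terms whose variable of smallest rank is `i`, divided by
that variable. -/
noncomputable def headQuotient (ρ : σ → ℕ) (i : σ) (p : MvPolynomial σ K) : MvPolynomial σ K :=
  tailPart ρ (ρ i) (divMonomial p (Finsupp.single i 1))

open Classical in
theorem coeff_headQuotient (i : σ) (p : MvPolynomial σ K) (m : σ →₀ ℕ) :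
    coeff m (headQuotient ρ i p) =
      if m ∈ tailExponents ρ (ρ i) then coeff (Finsupp.single i 1 + m) p else 0 := by
  unfold headQuotient
  rw [coeff_tailPart, coeff_divMonomial]

theorem tailPart_mem (p : MvPolynomial σ K) : tailPart ρ c p ∈ tailPolynomials K ρ c := by
  rw [mem_tailPolynomials]
  intro m hm
  rw [coeff_tailPart] at hm
  by_contra h
  simp [h] at hm

theorem headQuotient_mem (i : σ) (p : MvPolynomial σ K) :
    headQuotient ρ i p ∈ tailPolynomials K ρ (ρ i) := tailPart_mem _

theorem tailPart_add (p q : MvPolynomial σ K) :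
    tailPart ρ c (p + q) = tailPart ρ c p + tailPart ρ c q := by
  ext m
  simp only [coeff_add, coeff_tailPart]
  split_ifs <;> simp

theorem tailPart_smul (a : K) (p : MvPolynomial σ K) :
    tailPart ρ c (a • p) = a • tailPart ρ c p := by
  ext m
  simp only [coeff_smul, coeff_tailPart]
  split_ifs <;> simp

theorem headQuotient_add (i : σ) (p q : MvPolynomial σ K) :
    headQuotient ρ i (p + q) = headQuotient ρ i p + headQuotient ρ i q := by
  ext m
  simp only [coeff_add, coeff_headQuotient]
  split_ifs <;> simp

theorem headQuotient_smul (i : σ) (a : K) (p : MvPolynomial σ K) :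
    headQuotient ρ i (a • p) = a • headQuotient ρ i p := by
  ext m
  simp only [coeff_smul, coeff_headQuotient]
  split_ifs <;> simp

theorem totalDegree_tailPart_le (p : MvPolynomial σ K) :
    (tailPart ρ c p).totalDegree ≤ p.totalDegree := by
  classical
  refine totalDegree_le_of_support_subset fun m hm => ?_
  rw [mem_support_iff, coeff_tailPart] at hm
  exact mem_support_iff.2 fun h => hm (by simp [h])

theorem totalDegree_headQuotient_lt {i : σ} {p : MvPolynomial σ K} (h : headQuotient ρ i p ≠ 0) :
    (headQuotient ρ i p).totalDegree + 1 ≤ p.totalDegree := by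
  classical
  obtain ⟨m, hm, hd⟩ := Finset.exists_mem_eq_sup _ (support_nonempty.2 h)
    (fun m : σ →₀ ℕ => m.sum fun _ e => e)
  rw [mem_support_iff, coeff_headQuotient] at hm
  have := le_totalDegree (p := p) (s := Finsupp.single i 1 + m)
    (mem_support_iff.2 fun h => hm (by simp [h]))
  rw [Finsupp.sum_add_index' (fun _ => rfl) (fun _ _ _ => rfl), Finsupp.sum_single_index rfl] at this
  unfold totalDegree at *
  omega

/-- A polynomial vanishes when its part in the variables of rank at least `c` and its quotients
by the variables of smaller rank do. -/
theorem eq_zero_of_headQuotient_eq_zero [Finite σ] {p : MvPolynomial σ K}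
    (h : ∀ i, ρ i < c → headQuotient ρ i p = 0) (h' : tailPart ρ c p = 0) : p = 0 := by
  classical
  have := Fintype.ofFinite σ
  ext m
  rw [coeff_zero]
  by_cases hm : m ∈ tailExponents ρ c
  · have := congrArg (coeff m) h'
    simpa [coeff_tailPart, hm] using this
  · have hne : (Finset.univ.filter fun i => m i ≠ 0 ∧ ρ i < c).Nonempty := by
      by_contra! h0
      rw [Finset.filter_eq_empty_iff] at h0
      refine hm fun i hi => ?_
      by_contra h1
      exact h0 (Finset.mem_univ i) ⟨hi, by omega⟩
    -- A monomial outside the tail is recorded in the quotient by its variable of smallest rank.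
    obtain ⟨i, hi, hmin⟩ := Finset.exists_min_image _ ρ hne
    simp only [Finset.mem_filter, Finset.mem_univ, true_and] at hi hmin
    have hle : Finsupp.single i 1 ≤ m := by
      rw [Finsupp.single_le_iff]; omega
    have h1 := congrArg (coeff (m - Finsupp.single i 1)) (h i hi.2)
    rw [coeff_headQuotient, if_pos, add_tsub_cancel_of_le hle] at h1
    · simpa using h1
    · intro j hj
      by_cases hjc : ρ j < c
      · refine hmin j ⟨fun h0 => hj (by simp [h0]), hjc⟩
      · omega

/-- A finite family `h` of elements of a module, with classes `c`, such that every element of the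
submodule generated by `h` has a unique expression `∑ qⱼ hⱼ` in which `qⱼ` involves only variables
of rank at least `cⱼ`; existence is stated in the form of linear rewriting rules. -/
structure IsPommaretBasis {ι M : Type*} [Fintype ι] [AddCommGroup M] [Module (MvPolynomial σ K) M]
    (ρ : σ → ℕ) (h : ι → M) (c : ι → ℕ) : Prop where
  eq_zero : ∀ q : ι → MvPolynomial σ K, (∀ j, q j ∈ tailPolynomials K ρ (c j)) →
    ∑ j, q j • h j = 0 → q = 0
  exists_rewrite : ∀ j i, ρ i < c j → ∃ p : ι → MvPolynomial σ K,
    (∀ l, p l ∈ tailPolynomials K ρ (c l)) ∧ (∀ l, (p l).IsHomogeneous 1) ∧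
      (X i : MvPolynomial σ K) • h j = ∑ l, p l • h l

/-! ### Normal forms of vectors modulo the rewriting syzygies -/

section Syzygies

variable {ι : Type*} [DecidableEq ι] {c : ι → ℕ}

/-- The syzygy `xᵢ eⱼ - p` coming from the rewriting of `xᵢ hⱼ`, where `x = (j, i)`. -/
noncomputable def rewriteSyzygy (p : {x : ι × σ // ρ x.2 < c x.1} → ι → MvPolynomial σ K)
    (x : {x : ι × σ // ρ x.2 < c x.1}) : ι → MvPolynomial σ K :=
  Pi.single x.1.1 (X x.1.2) - p x

theorem rewriteSyzygy_isHomogeneous {p : {x : ι × σ // ρ x.2 < c x.1} → ι → MvPolynomial σ K}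
    (hp : ∀ x l, (p x l).IsHomogeneous 1) (x : {x : ι × σ // ρ x.2 < c x.1}) (l : ι) :
    (rewriteSyzygy p x l).IsHomogeneous 1 := by
  refine IsHomogeneous.sub ?_ (hp x l)
  by_cases h : l = x.1.1
  · subst h
    simpa using isHomogeneous_X K x.1.2
  · simpa [Pi.single_eq_of_ne h] using isHomogeneous_zero σ K 1

variable [Fintype {x : ι × σ // ρ x.2 < c x.1}]

/-- Let `i` be the variable of least rank occurring with some `q x ≠ 0`, and among the indices with
this variable let `z` maximize the `i`-degree of `q z`. In the coordinate of `z`, the term `q z * X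
i` has larger `i`-degree than every other term: there `p` and `w` are free of `X i`, and any other
product in that coordinate is by a different variable. So nothing can cancel it. -/
theorem rewriteSyzygy_eq_zero (hρ : Function.Injective ρ)
    {p : {x : ι × σ // ρ x.2 < c x.1} → ι → MvPolynomial σ K}
    (hp : ∀ x l, p x l ∈ tailPolynomials K ρ (c l))
    {q : {x : ι × σ // ρ x.2 < c x.1} → MvPolynomial σ K} {w : ι → MvPolynomial σ K}
    (hq : ∀ x, q x ∈ tailPolynomials K ρ (ρ x.1.2)) (hw : ∀ l, w l ∈ tailPolynomials K ρ (c l))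
    (h : ∑ x, q x • rewriteSyzygy p x + w = 0) : q = 0 ∧ w = 0 := by
  classical
  suffices hq0 : q = 0 by
    subst hq0
    simpa using h
  by_contra hq0
  obtain ⟨x₀, hx₀⟩ := Function.ne_iff.1 hq0
  obtain ⟨y, hy, hymin⟩ := Finset.exists_min_image (Finset.univ.filter fun x => q x ≠ 0)
    (fun x => ρ x.1.2) ⟨x₀, by simpa using hx₀⟩
  obtain ⟨z, hz, hzmax⟩ := Finset.exists_max_image
    (Finset.univ.filter fun x => q x ≠ 0 ∧ x.1.2 = y.1.2) (fun x => degreeOf y.1.2 (q x))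
    ⟨y, by simpa using hy⟩
  simp only [Finset.mem_filter, Finset.mem_univ, true_and] at hy hymin hz hzmax
  set i := y.1.2 with hi
  have hdeg (x) (hx : x.1.2 ≠ i) : degreeOf i (q x) = 0 := by
    by_cases h0 : q x = 0
    · simp [h0]
    · refine degreeOf_eq_zero_of_mem_tailPolynomials (hq x) (lt_of_le_of_ne (hymin x h0) ?_)
      exact fun h1 => hx (hρ h1).symm
  have hle (x) : degreeOf i (q x) ≤ degreeOf i (q z) := by
    by_cases h0 : q x = 0
    · simp [h0]
    · by_cases h1 : x.1.2 = i
      · exact hzmax x ⟨h0, h1⟩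
      · simp [hdeg x h1]
  have hic : ρ i < c z.1.1 := hz.2 ▸ z.2
  have hcoord := congrFun h z.1.1
  simp only [Pi.add_apply, Finset.sum_apply, Pi.smul_apply, smul_eq_mul, Pi.zero_apply,
    rewriteSyzygy, Pi.sub_apply] at hcoord
  rw [← Finset.add_sum_erase _ _ (Finset.mem_univ z), Pi.single_eq_same, hz.2] at hcoord
  have hpz (x) : degreeOf i (q x * p x z.1.1) ≤ degreeOf i (q z) := by
    refine (degreeOf_mul_le _ _ _).trans ?_
    rw [degreeOf_eq_zero_of_mem_tailPolynomials (hp x z.1.1) hic]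
    exact hle x
  have key : q z * X i = q z * p z z.1.1 - w z.1.1 -
      ∑ x ∈ Finset.univ.erase z,
        q x * ((Pi.single x.1.1 (X x.1.2) : ι → MvPolynomial σ K) z.1.1 - p x z.1.1) := by
    linear_combination hcoord
  have h1 : degreeOf i (q z * X i) = degreeOf i (q z) + 1 :=
    (degreeOf_mul_X_eq_degreeOf_add_one_iff _ _).2 hz.1
  have h2 : degreeOf i (q z * X i) ≤ degreeOf i (q z) := by
    rw [key]
    refine (degreeOf_sub_le _ _ _).trans (max_le ((degreeOf_sub_le _ _ _).trans
      (max_le (hpz z) ?_)) ((degreeOf_sum_le _ _ _).trans (Finset.sup_le fun x hx => ?_)))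
    · rw [degreeOf_eq_zero_of_mem_tailPolynomials (hw _) hic]
      exact Nat.zero_le _
    · rw [mul_sub]
      refine (degreeOf_sub_le _ _ _).trans (max_le ?_ (hpz x))
      by_cases h3 : x.1.1 = z.1.1
      · have h4 : x.1.2 ≠ i := fun h4 =>
          (Finset.mem_erase.1 hx).1 (Subtype.ext (Prod.ext h3 (h4.trans hz.2.symm)))
        rw [h3, Pi.single_eq_same, degreeOf_mul_X_of_ne _ h4.symm]
        exact hle x
      · rw [Pi.single_eq_of_ne (Ne.symm h3), mul_zero, degreeOf_zero]
        exact Nat.zero_le _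
  omega

/-- Existence follows from uniqueness by dimension, without proving that rewriting terminates. The
`K`-linear map `T` splits each coordinate into its tail and its head quotients and replaces each `X
i • eⱼ` by the corresponding syzygy. It is injective by `rewriteSyzygy_eq_zero` and, the syzygies
being linear, preserves the finite-dimensional space of vectors of degree at most `N`. Hence it is
surjective there. -/
theorem exists_eq_sum_rewriteSyzygy_add [Fintype ι] [Finite σ] (hρ : Function.Injective ρ)
    {p : {x : ι × σ // ρ x.2 < c x.1} → ι → MvPolynomial σ K}
    (hp : ∀ x l, p x l ∈ tailPolynomials K ρ (c l)) (hp1 : ∀ x l, (p x l).IsHomogeneous 1)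
    (a : ι → MvPolynomial σ K) :
    ∃ (q : {x : ι × σ // ρ x.2 < c x.1} → MvPolynomial σ K) (w : ι → MvPolynomial σ K),
      (∀ x, q x ∈ tailPolynomials K ρ (ρ x.1.2)) ∧ (∀ l, w l ∈ tailPolynomials K ρ (c l)) ∧
      a = ∑ x, q x • rewriteSyzygy p x + w := by
  classical
  let T : (ι → MvPolynomial σ K) →ₗ[K] (ι → MvPolynomial σ K) :=
    { toFun := fun a => ∑ x, headQuotient ρ x.1.2 (a x.1.1) • rewriteSyzygy p x +
        fun l => tailPart ρ (c l) (a l)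
      map_add' := fun a b => by
        simp only [Pi.add_apply, headQuotient_add, tailPart_add, add_smul, Finset.sum_add_distrib]
        rw [show (fun l => tailPart ρ (c l) (a l) + tailPart ρ (c l) (b l)) =
          (fun l => tailPart ρ (c l) (a l)) + fun l => tailPart ρ (c l) (b l) from rfl]
        abel
      map_smul' := fun r a => by
        simp only [Pi.smul_apply, headQuotient_smul, tailPart_smul, smul_assoc, RingHom.id_apply,
          smul_add, Finset.smul_sum]
        rfl }
  have hinj : Function.Injective T := by
    rw [← LinearMap.ker_eq_bot, LinearMap.ker_eq_bot']
    intro a ha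
    obtain ⟨h1, h2⟩ := rewriteSyzygy_eq_zero hρ hp (fun x => headQuotient_mem x.1.2 (a x.1.1))
      (fun l => tailPart_mem (a l)) ha
    funext l
    exact eq_zero_of_headQuotient_eq_zero (fun i hi => congrFun h1 ⟨(l, i), hi⟩) (congrFun h2 l)
  let N := Finset.univ.sup fun l => (a l).totalDegree
  let E : Submodule K (ι → MvPolynomial σ K) :=
    Submodule.pi Set.univ fun _ => restrictTotalDegree σ K N
  have hE (b : ι → MvPolynomial σ K) : b ∈ E ↔ ∀ l, (b l).totalDegree ≤ N := by
    simp [E, Submodule.mem_pi, mem_restrictTotalDegree]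
  have hTE : ∀ b ∈ E, T b ∈ E := by
    intro b hb
    rw [hE] at hb ⊢
    intro l
    refine (totalDegree_add _ _).trans (max_le ?_ ((totalDegree_tailPart_le _).trans (hb l)))
    rw [Finset.sum_apply]
    refine (totalDegree_finsetSum _ _).trans (Finset.sup_le fun x _ => ?_)
    by_cases h0 : headQuotient ρ x.1.2 (b x.1.1) = 0
    · simp [h0]
    · refine (totalDegree_mul _ _).trans (le_trans ?_
        ((totalDegree_headQuotient_lt h0).trans (hb x.1.1)))
      have := (rewriteSyzygy_isHomogeneous hp1 x l).totalDegree_le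
      omega
  have : FiniteDimensional K E := by
    let e : E →ₗ[K] (ι → restrictTotalDegree σ K N) :=
      LinearMap.pi fun l => LinearMap.codRestrict _ ((LinearMap.proj l).comp E.subtype)
        fun b => b.2 l (Set.mem_univ l)
    refine FiniteDimensional.of_injective e fun b b' hbb => Subtype.ext (funext fun l => ?_)
    exact congrArg Subtype.val (congrFun hbb l)
  have hsurj : Function.Surjective (T.restrict hTE) := by
    refine LinearMap.injective_iff_surjective.1 fun b b' hbb => Subtype.ext (hinj ?_)
    exact congrArg Subtype.val hbb
  obtain ⟨b, hb⟩ := hsurj ⟨a, (hE a).2 fun l => Finset.le_sup (f := fun l => (a l).totalDegree)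
    (Finset.mem_univ l)⟩
  exact ⟨_, _, fun x => headQuotient_mem x.1.2 (b.1 x.1.1), fun l => tailPart_mem (b.1 l),
    (congrArg Subtype.val hb).symm⟩

end Syzygies

/-- The syzygies of a Pommaret basis have a Pommaret basis, consisting of vectors of linear forms,
of smaller classes. -/
theorem IsPommaretBasis.exists_syzygies [Finite σ] (hρ : Function.Injective ρ) {ι M : Type*}
    [Fintype ι] [AddCommGroup M] [Module (MvPolynomial σ K) M] {h : ι → M} {c : ι → ℕ}
    (hh : IsPommaretBasis (K := K) ρ h c) :
    ∃ (r : ℕ) (A : Matrix ι (Fin r) (MvPolynomial σ K)) (c' : Fin r → ℕ),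
      (∀ a b, (A a b).IsHomogeneous 1) ∧ (∀ b, ∃ a, c' b < c a) ∧
      Function.Exact A.mulVecLin (Fintype.linearCombination (MvPolynomial σ K) h) ∧
      IsPommaretBasis (K := K) ρ A.col c' := by
  classical
  have := Fintype.ofFinite σ
  choose! p hpt hp1 hph using fun x : {x : ι × σ // ρ x.2 < c x.1} =>
    hh.exists_rewrite x.1.1 x.1.2 x.2
  have hsyz (x) : ∑ l, rewriteSyzygy p x l • h l = 0 := by
    simp only [rewriteSyzygy, Pi.sub_apply, sub_smul, Finset.sum_sub_distrib, ← hph x]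
    rw [Finset.sum_eq_single x.1.1 (fun l _ hl => by rw [Pi.single_eq_of_ne hl, zero_smul])
      (fun h => absurd (Finset.mem_univ _) h), Pi.single_eq_same, sub_self]
  have hsum (q : {x : ι × σ // ρ x.2 < c x.1} → MvPolynomial σ K) :
      ∑ l, (∑ x, q x • rewriteSyzygy p x) l • h l = 0 := by
    simp only [Finset.sum_apply, Pi.smul_apply, Finset.sum_smul, smul_assoc]
    rw [Finset.sum_comm]
    refine Finset.sum_eq_zero fun x _ => ?_
    rw [← Finset.smul_sum, hsyz, smul_zero]
  -- The remainder `w` of a syzygy is itself a syzygy with coefficients in the tails, so it vanishes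
  -- by uniqueness for `h`.
  have hspan (a : ι → MvPolynomial σ K) (ha : ∑ l, a l • h l = 0) :
      ∃ q : {x : ι × σ // ρ x.2 < c x.1} → MvPolynomial σ K,
        (∀ x, q x ∈ tailPolynomials K ρ (ρ x.1.2)) ∧ a = ∑ x, q x • rewriteSyzygy p x := by
    obtain ⟨q, w, hq, hw, rfl⟩ := exists_eq_sum_rewriteSyzygy_add hρ hpt hp1 a
    refine ⟨q, hq, ?_⟩
    rw [hh.eq_zero w hw, add_zero]
    simpa only [Pi.add_apply, add_smul, Finset.sum_add_distrib, hsum, zero_add] using ha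
  let e := Fintype.equivFin {x : ι × σ // ρ x.2 < c x.1}
  refine ⟨_, Matrix.of fun l b => rewriteSyzygy p (e.symm b) l, fun b => ρ (e.symm b).1.2,
    fun l b => rewriteSyzygy_isHomogeneous hp1 _ l, fun b => ⟨_, (e.symm b).2⟩, ?_, ?_, ?_⟩
  · intro a
    rw [Fintype.linearCombination_apply]
    constructor
    · intro ha
      obtain ⟨q, -, rfl⟩ := hspan a ha
      refine ⟨q ∘ e.symm, ?_⟩
      funext l
      simp only [Matrix.mulVecLin_apply, Matrix.mulVec, dotProduct, Matrix.of_apply,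
        Function.comp_apply, Finset.sum_apply, Pi.smul_apply, smul_eq_mul]
      rw [e.symm.sum_comp fun x => rewriteSyzygy p x l * q x]
      exact Finset.sum_congr rfl fun x _ => mul_comm _ _
    · rintro ⟨v, rfl⟩
      rw [← hsum (v ∘ e)]
      refine Finset.sum_congr rfl fun l _ => ?_
      congr 1
      simp only [Matrix.mulVecLin_apply, Matrix.mulVec, dotProduct, Matrix.of_apply,
        Function.comp_apply, Finset.sum_apply, Pi.smul_apply, smul_eq_mul]
      rw [← e.symm.sum_comp fun x => v (e x) * rewriteSyzygy p x l]
      exact Finset.sum_congr rfl fun x _ => by rw [e.apply_symm_apply, mul_comm]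
  · intro q hq h0
    have h1 := (rewriteSyzygy_eq_zero hρ hpt (q := q ∘ e) (w := 0)
      (fun x => by simpa using hq (e x)) (fun l => Submodule.zero_mem _) (by
        rw [add_zero, ← h0, ← e.sum_comp]
        refine Finset.sum_congr rfl fun x _ => ?_
        funext l
        simp [Matrix.col])).1
    funext b
    simpa using congrFun h1 (e.symm b)
  -- The coefficients from `hspan` need not be homogeneous. Comparing components of degree 2 retains
  -- just their linear parts, since the syzygies have linear entries.
  · intro b i _
    obtain ⟨q, hq, hqs⟩ := hspan ((X i : MvPolynomial σ K) • rewriteSyzygy p (e.symm b)) (by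
      simp only [Pi.smul_apply, smul_assoc]
      rw [← Finset.smul_sum, hsyz, smul_zero])
    refine ⟨fun b => homogeneousComponent 1 (q (e.symm b)),
      fun b => homogeneousComponent_mem_tailPolynomials (hq _) _,
      fun b => homogeneousComponent_isHomogeneous _ _, ?_⟩
    funext l
    have h1 := congrArg (homogeneousComponent 2) (congrFun hqs l)
    have h2 := rewriteSyzygy_isHomogeneous hp1 (e.symm b) l
    simp only [Pi.smul_apply, smul_eq_mul, Finset.sum_apply, map_sum] at h1 ⊢
    rw [homogeneousComponent_of_mem (m := 2) ((isHomogeneous_X K i).mul h2), if_pos rfl] at h1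
    rw [← e.sum_comp]
    refine h1.trans (Finset.sum_congr rfl fun x _ => ?_)
    have h3 := rewriteSyzygy_isHomogeneous hp1 x l
    simp only [e.symm_apply_apply, Matrix.col_apply, Matrix.of_apply]
    rw [homogeneousComponent_mul_of_isHomogeneous h3, if_pos (by norm_num)]

/-- A matrix of linear forms whose columns form a Pommaret basis. -/
structure PommaretMatrix (K : Type*) [Field K] (ρ : σ → ℕ) where
  rows : ℕ
  cols : ℕ
  matrix : Matrix (Fin rows) (Fin cols) (MvPolynomial σ K)
  cls : Fin cols → ℕ
  isHomogeneous : ∀ a b, (matrix a b).IsHomogeneous 1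
  isPommaretBasis : IsPommaretBasis (K := K) ρ matrix.col cls

/-- The next matrix in the resolution. -/
noncomputable def PommaretMatrix.next [Finite σ] (hρ : Function.Injective ρ)
    (s : PommaretMatrix K ρ) : PommaretMatrix K ρ where
  rows := s.cols
  cols := (s.isPommaretBasis.exists_syzygies hρ).choose
  matrix := (s.isPommaretBasis.exists_syzygies hρ).choose_spec.choose
  cls := (s.isPommaretBasis.exists_syzygies hρ).choose_spec.choose_spec.choose
  isHomogeneous := (s.isPommaretBasis.exists_syzygies hρ).choose_spec.choose_spec.choose_spec.1
  isPommaretBasis :=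
    (s.isPommaretBasis.exists_syzygies hρ).choose_spec.choose_spec.choose_spec.2.2.2

/-- This strict descent of classes makes the resolution finite. -/
theorem PommaretMatrix.exists_cls_lt [Finite σ] (hρ : Function.Injective ρ)
    (s : PommaretMatrix K ρ) (b : Fin (s.next hρ).cols) : ∃ a, (s.next hρ).cls b < s.cls a :=
  (s.isPommaretBasis.exists_syzygies hρ).choose_spec.choose_spec.choose_spec.2.1 b

theorem PommaretMatrix.exact_next [Finite σ] (hρ : Function.Injective ρ)
    (s : PommaretMatrix K ρ) :
    Function.Exact (s.next hρ).matrix.mulVecLin s.matrix.mulVecLin := by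
  have h := (s.isPommaretBasis.exists_syzygies hρ).choose_spec.choose_spec.choose_spec.2.2.1
  have hcol : s.matrix.mulVecLin = Fintype.linearCombination (MvPolynomial σ K) s.matrix.col := by
    refine LinearMap.ext fun v => funext fun i => ?_
    simp [Fintype.linearCombination_apply, Matrix.mulVec, dotProduct, mul_comm]
  rw [hcol]
  exact h

/-- An ideal with a Pommaret basis consisting of forms of degree `d` has a linear resolution. -/
theorem IsPommaretBasis.hasLinearResolution {n : ℕ} {ρ : Fin n → ℕ} (hρ : Function.Injective ρ)
    {r : ℕ} {ε : Fin r → MvPolynomial (Fin n) K} {c : Fin r → ℕ}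
    (h : IsPommaretBasis (K := K) ρ ε c) {d : ℕ} (hd : ∀ j, (ε j).IsHomogeneous d) :
    HasLinearResolution d (Ideal.span (Set.range ε)) := by
  obtain ⟨r₁, A, c₁, hA, hc, hex, hP⟩ := h.exists_syzygies hρ
  let s : ℕ → PommaretMatrix K ρ := fun i => Nat.rec ⟨r, r₁, A, c₁, hA, hP⟩ (fun _ t => t.next hρ) i
  let N := Finset.univ.sup c₁ + 1
  have hN (i : ℕ) : ∀ b, (s i).cls b + i < N := by
    induction i with
    | zero => exact fun b => Nat.lt_succ_of_le (Finset.le_sup (f := c₁) (Finset.mem_univ b))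
    | succ i ih =>
      intro b
      obtain ⟨a, ha⟩ := (s i).exists_cls_lt hρ b
      have h1 := ih a
      have h2 : (s (i + 1)).cls b < (s i).cls a := ha
      omega
  refine ⟨N, fun i => (s i).rows, ε, fun i => (s i).matrix, ?_, hd,
    fun i => (s i).isHomogeneous, rfl, hex, fun i => (s i).exact_next hρ⟩
  rintro (_ | i) hi
  · omega
  · by_contra h0
    have h1 := hN i (⟨0, Nat.pos_of_ne_zero h0⟩ : Fin (s (i + 1)).rows)
    omega

end PommaretBasis

/-! ### Invariance under linear changes of coordinates -/

section LinearChange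

open MvPolynomial

variable {K : Type*} [Field K] {n : ℕ}

theorem linearChange_X (g : Matrix (Fin n) (Fin n) K) (j : Fin n) :
    linearChange g (X j) = ∑ i, C (g i j) * X i := by
  simp [linearChange]

theorem linearChange_linearChange (g h : Matrix (Fin n) (Fin n) K)
    (f : MvPolynomial (Fin n) K) :
    linearChange g (linearChange h f) = linearChange (g * h) f := by
  rw [← AlgHom.comp_apply]
  congr 1
  refine MvPolynomial.algHom_ext fun j => ?_
  rw [AlgHom.comp_apply, linearChange_X, linearChange_X]
  have hC (a : K) : linearChange g (C a) = C a := (linearChange g).commutes a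
  simp only [map_sum, map_mul, hC, linearChange_X, Matrix.mul_apply, Finset.mul_sum,
    Finset.sum_mul]
  rw [Finset.sum_comm]
  refine Finset.sum_congr rfl fun i _ => Finset.sum_congr rfl fun j _ => ?_
  ring

theorem linearChange_one (f : MvPolynomial (Fin n) K) :
    linearChange (1 : Matrix (Fin n) (Fin n) K) f = f := by
  suffices h : linearChange (1 : Matrix (Fin n) (Fin n) K) = AlgHom.id K _ by rw [h]; rfl
  refine MvPolynomial.algHom_ext fun j => ?_
  rw [linearChange_X, Finset.sum_eq_single j] <;> simp +contextual

theorem linearChange_isHomogeneous (g : Matrix (Fin n) (Fin n) K) {f : MvPolynomial (Fin n) K}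
    {d : ℕ} (hf : f.IsHomogeneous d) : (linearChange g f).IsHomogeneous d := by
  have := hf.aeval (fun j => ∑ i, C (g i j) * X i) (n := 1)
    (fun j => IsHomogeneous.sum _ _ _ fun i _ => isHomogeneous_C_mul_X _ _)
  rwa [one_mul] at this

/-- The automorphism given by an invertible linear change of coordinates. -/
noncomputable def linearChangeEquiv (g : GL (Fin n) K) :
    MvPolynomial (Fin n) K ≃ₐ[K] MvPolynomial (Fin n) K :=
  AlgEquiv.ofAlgHom (linearChange g.val) (linearChange (g⁻¹).val)
    (AlgHom.ext fun f => by
      rw [AlgHom.comp_apply, linearChange_linearChange, ← Units.val_mul, mul_inv_cancel,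
        Units.val_one, linearChange_one, AlgHom.id_apply])
    (AlgHom.ext fun f => by
      rw [AlgHom.comp_apply, linearChange_linearChange, ← Units.val_mul, inv_mul_cancel,
        Units.val_one, linearChange_one, AlgHom.id_apply])

theorem linearChangeEquiv_symm_apply (g : GL (Fin n) K) (f : MvPolynomial (Fin n) K) :
    (linearChangeEquiv g).symm f = linearChange (g⁻¹).val f := rfl

/-- Exactness is preserved by applying bijections to the entries. -/
theorem Function.Exact.of_semiconj {A B C A' B' C' : Type*} [Zero C] [Zero C'] {f : A → B}
    {g : B → C} (h : Function.Exact f g) (a : A → A') (b : B ≃ B') (c : C → C')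
    (hc : Function.Injective c) (hc0 : c 0 = 0) (ha : Function.Surjective a)
    {f' : A' → B'} {g' : B' → C'} (hf : ∀ x, f' (a x) = b (f x)) (hg : ∀ x, g' (b x) = c (g x)) :
    Function.Exact f' g' := by
  intro y
  obtain ⟨y, rfl⟩ := b.surjective y
  rw [hg, ← hc0, hc.eq_iff, h y]
  constructor
  · rintro ⟨x, rfl⟩
    exact ⟨a x, hf x⟩
  · rintro ⟨x', hx'⟩
    obtain ⟨x, rfl⟩ := ha x'
    exact ⟨x, b.injective ((hf x).symm.trans hx')⟩

/-- Applying `φ` to all coordinates is not linear over the polynomial ring, so exactness is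
transported along bijections by `Function.Exact.of_semiconj`. -/
theorem HasLinearResolution.map {d : ℕ} {I : Ideal (MvPolynomial (Fin n) K)}
    (h : HasLinearResolution d I) (φ : MvPolynomial (Fin n) K ≃ₐ[K] MvPolynomial (Fin n) K)
    (hφ : ∀ f e, f.IsHomogeneous e → (φ f).IsHomogeneous e) :
    HasLinearResolution d (I.map φ) := by
  obtain ⟨s, β, ε, A, hβ, hε, hA, hI, hex₀, hex⟩ := h
  have hmul {a b : ℕ} (M : Matrix (Fin a) (Fin b) (MvPolynomial (Fin n) K))
      (v : Fin b → MvPolynomial (Fin n) K) :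
      (M.map φ).mulVecLin (fun i => φ (v i)) = fun i => φ (M.mulVecLin v i) := by
    funext i
    simp [Matrix.mulVec, dotProduct]
  have hsurj (b : ℕ) : Function.Surjective
      fun (v : Fin b → MvPolynomial (Fin n) K) i => φ (v i) := fun w =>
    ⟨fun i => φ.symm (w i), funext fun i => φ.apply_symm_apply _⟩
  have hinj (b : ℕ) : Function.Injective
      fun (v : Fin b → MvPolynomial (Fin n) K) i => φ (v i) := fun v w hvw =>
    funext fun i => φ.injective (congrFun hvw i)
  refine ⟨s, β, φ ∘ ε, fun i => (A i).map φ, hβ, fun j => hφ _ _ (hε j),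
    fun i a b => hφ _ _ (hA i a b), ?_, ?_, fun i => ?_⟩
  · rw [← hI, Ideal.map_span, Set.range_comp]
  · refine hex₀.of_semiconj _ (Equiv.ofBijective _ ⟨hinj _, hsurj _⟩) φ φ.injective (map_zero φ)
      (hsurj _) (fun v => hmul _ v) fun v => ?_
    change Fintype.linearCombination _ (φ ∘ ε) (fun i => φ (v i)) = _
    simp [Fintype.linearCombination_apply]
  · refine (hex i).of_semiconj _ (Equiv.ofBijective _ ⟨hinj _, hsurj _⟩) _ (hinj _)
      (funext fun i => map_zero φ) (hsurj _) (fun v => hmul _ v) (fun v => hmul _ v)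

theorem mem_map_algEquiv (φ : MvPolynomial (Fin n) K ≃ₐ[K] MvPolynomial (Fin n) K)
    (J : Ideal (MvPolynomial (Fin n) K)) (f : MvPolynomial (Fin n) K) :
    f ∈ J.map φ ↔ φ.symm f ∈ J := by
  constructor
  · intro h
    have h1 : J.map φ ≤ J.comap φ.symm := by
      rw [Ideal.map_le_iff_le_comap]
      intro y hy
      rw [Ideal.mem_comap, Ideal.mem_comap, φ.symm_apply_apply]
      exact hy
    exact h1 h
  · intro h
    have := Ideal.mem_map_of_mem φ h
    rwa [φ.apply_symm_apply] at this

theorem map_degreeComponentIdeal (φ : MvPolynomial (Fin n) K ≃ₐ[K] MvPolynomial (Fin n) K)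
    (hφ : ∀ f e, f.IsHomogeneous e → (φ f).IsHomogeneous e)
    (hφ' : ∀ f e, f.IsHomogeneous e → (φ.symm f).IsHomogeneous e)
    (J : Ideal (MvPolynomial (Fin n) K)) (k : ℕ) :
    (degreeComponentIdeal J k).map φ = degreeComponentIdeal (J.map φ) k := by
  unfold degreeComponentIdeal
  rw [Ideal.map_span]
  congr 1
  ext f
  constructor
  · rintro ⟨f, ⟨h1, h2⟩, rfl⟩
    exact ⟨Ideal.mem_map_of_mem φ h1, hφ _ _ h2⟩
  · rintro ⟨h1, h2⟩
    exact ⟨φ.symm f, ⟨(mem_map_algEquiv φ J f).1 h1, hφ' _ _ h2⟩, φ.apply_symm_apply f⟩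

theorem IsComponentwiseLinear.of_map_linearChange {J : Ideal (MvPolynomial (Fin n) K)}
    {g : GL (Fin n) K} (h : IsComponentwiseLinear (J.map (linearChange g.val))) :
    IsComponentwiseLinear J := by
  intro k
  set φ := linearChangeEquiv g
  have h1 := (h k).map φ.symm fun f e => linearChange_isHomogeneous (g⁻¹).val
  have h2 : J.map (linearChange g.val) = J.map φ := rfl
  have h3 := map_degreeComponentIdeal φ (fun f e => linearChange_isHomogeneous g.val)
    (fun f e => linearChange_isHomogeneous (g⁻¹).val) J k
  rw [h2, ← h3] at h1
  convert h1 using 1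
  ext f
  rw [mem_map_algEquiv, mem_map_algEquiv, AlgEquiv.symm_symm, φ.symm_apply_apply]

theorem IsMinimalHomogeneousGenerators.image_linearChange [DecidableEq (MvPolynomial (Fin n) K)]
    {J : Ideal (MvPolynomial (Fin n) K)} {S : Finset (MvPolynomial (Fin n) K)}
    (hS : IsMinimalHomogeneousGenerators J S) (g : GL (Fin n) K) :
    IsMinimalHomogeneousGenerators (J.map (linearChange g.val)) (S.image (linearChange g.val)) where
  homogeneous := by
    intro f hf
    obtain ⟨f, hfS, rfl⟩ := Finset.mem_image.1 hf
    exact (hS.homogeneous f hfS).imp fun d => linearChange_isHomogeneous _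
  span_eq := by rw [← hS.span_eq, Ideal.map_span, Finset.coe_image]
  minimal := by
    intro f hf
    obtain ⟨f, hfS, rfl⟩ := Finset.mem_image.1 hf
    have hinj : Function.Injective (linearChange g.val) := (linearChangeEquiv g).injective
    intro h
    rw [Finset.coe_image, ← Set.image_singleton, ← Set.image_sdiff hinj, ← Ideal.map_span] at h
    have h1 := (mem_map_algEquiv (linearChangeEquiv g) _ _).1 h
    rw [linearChangeEquiv_symm_apply, linearChange_linearChange, ← Units.val_mul, inv_mul_cancel,
      Units.val_one, linearChange_one] at h1
    exact hS.minimal f hfS h1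

end LinearChange

/-! ### Leading exponents and minimal generators -/

section LeadingExponents

open MvPolynomial

variable {σ K : Type*} [Field K]

/-- The leading exponents of the nonzero elements of a space of polynomials. -/
def leadingExponents (m : MonomialOrder σ) (W : Submodule K (MvPolynomial σ K)) :
    Set (σ →₀ ℕ) :=
  {u | ∃ f ∈ W, f ≠ 0 ∧ m.degree f = u}

theorem leadingExponents_mono (m : MonomialOrder σ) {W W' : Submodule K (MvPolynomial σ K)}
    (h : W ≤ W') : leadingExponents m W ⊆ leadingExponents m W' :=
  fun _ ⟨f, hf, hu⟩ => ⟨f, h hf, hu⟩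

/-- A sum of nonzero polynomials with distinct leading exponents is nonzero. -/
theorem MonomialOrder.sum_ne_zero_of_degree_injOn (m : MonomialOrder σ) {ι : Type*}
    {s : Finset ι} (hs : s.Nonempty) {f : ι → MvPolynomial σ K} (hf : ∀ j ∈ s, f j ≠ 0)
    (hinj : Set.InjOn (fun j => m.degree (f j)) s) : ∑ j ∈ s, f j ≠ 0 := by
  obtain ⟨j, hj, hmax⟩ := Finset.exists_max_image s (fun j => m.toSyn (m.degree (f j))) hs
  intro h
  have h1 := congrArg (coeff (m.degree (f j))) h
  rw [coeff_sum, Finset.sum_eq_single j, coeff_zero, m.coeff_degree_eq_zero_iff] at h1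
  · exact hf j hj h1
  · intro i hi hij
    refine m.coeff_eq_zero_of_lt (lt_of_le_of_ne (hmax i hi) fun h2 => hij ?_)
    exact hinj hi hj (m.toSyn.injective h2)
  · exact fun h2 => absurd hj h2

theorem MonomialOrder.linearIndependent_of_degree_injective (m : MonomialOrder σ) {ι : Type*}
    {f : ι → MvPolynomial σ K} (hf : ∀ j, f j ≠ 0)
    (hinj : Function.Injective fun j => m.degree (f j)) : LinearIndependent K f := by
  classical
  rw [linearIndependent_iff']
  intro s a h0 i hi
  by_contra hai
  have hdeg (j) (hj : a j ≠ 0) : m.degree (a j • f j) = m.degree (f j) :=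
    m.degree_smul_of_isRegular (IsRegular.of_ne_zero hj)
  refine m.sum_ne_zero_of_degree_injOn (s := s.filter fun j => a j ≠ 0) (f := fun j => a j • f j)
    ⟨i, by simp [hi, hai]⟩ (fun j hj => ?_) (fun j hj l hl h => ?_) ?_
  · exact smul_ne_zero (Finset.mem_filter.1 hj).2 (hf j)
  · refine hinj ?_
    simp only [Finset.coe_filter, Set.mem_ofPred_eq] at hj hl h
    simpa only [hdeg j hj.2, hdeg l hl.2] using h
  · rw [← h0, Finset.sum_filter_of_ne]
    intro j _ hj h
    exact hj (by rw [h, zero_smul])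

/-- A space of polynomials is spanned by elements realizing all leading exponents. -/
theorem MonomialOrder.span_eq_of_degree (m : MonomialOrder σ) {W : Submodule K (MvPolynomial σ K)}
    {F : leadingExponents m W → MvPolynomial σ K} (hFW : ∀ u, F u ∈ W) (hF : ∀ u, F u ≠ 0)
    (hdeg : ∀ u, m.degree (F u) = u) : Submodule.span K (Set.range F) = W := by
  refine le_antisymm (Submodule.span_le.2 (by rintro _ ⟨u, rfl⟩; exact hFW u)) fun f hf => ?_
  induction hd : m.toSyn (m.degree f) using WellFoundedLT.induction generalizing f with
  | ind d ih =>
    subst hd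
    by_cases hf0 : f = 0
    · rw [hf0]; exact Submodule.zero_mem _
    let u : leadingExponents m W := ⟨m.degree f, f, hf, hf0, rfl⟩
    set b := coeff (m.degree f) f / coeff (m.degree f) (F u) with hb
    have hne : coeff (m.degree f) (F u) ≠ 0 := by
      have := m.coeff_degree_ne_zero_iff.2 (hF u)
      rwa [hdeg u] at this
    have hFu : b • F u ∈ Submodule.span K (Set.range F) :=
      Submodule.smul_mem _ _ (Submodule.subset_span ⟨u, rfl⟩)
    rw [← sub_add_cancel f (b • F u)]
    refine Submodule.add_mem _ ?_ hFu
    by_cases h0 : f - b • F u = 0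
    · rw [h0]; exact Submodule.zero_mem _
    refine ih _ (lt_of_le_of_ne ?_ fun h => h0 ?_) _
      (Submodule.sub_mem _ hf (Submodule.smul_mem _ _ (hFW u))) rfl
    · refine m.degree_sub_le.trans (max_le le_rfl (m.degree_smul_le.trans ?_))
      rw [hdeg u]
    · rw [← m.coeff_degree_eq_zero_iff, m.toSyn.injective h, coeff_sub, coeff_smul, smul_eq_mul,
        hb, div_mul_cancel₀ _ hne, sub_self]

theorem exists_family_leadingExponents (m : MonomialOrder σ)
    (W : Submodule K (MvPolynomial σ K)) : ∃ F : leadingExponents m W → MvPolynomial σ K,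
      (∀ u, F u ∈ W) ∧ (∀ u, F u ≠ 0) ∧ ∀ u, m.degree (F u) = u := by
  choose F h1 h2 h3 using fun u : leadingExponents m W => u.2
  exact ⟨F, h1, h2, h3⟩

theorem finite_leadingExponents (m : MonomialOrder σ) (W : Submodule K (MvPolynomial σ K))
    [FiniteDimensional K W] : (leadingExponents m W).Finite := by
  obtain ⟨F, hFW, hF, hdeg⟩ := exists_family_leadingExponents m W
  have hli : LinearIndependent K F := m.linearIndependent_of_degree_injective hF fun u v h =>
    Subtype.ext (by simpa only [hdeg] using h)
  have hli' : LinearIndependent K fun u => (⟨F u, hFW u⟩ : W) :=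
    LinearIndependent.of_comp W.subtype hli
  have := hli'.finite_of_isNoetherian
  exact Set.toFinite _

theorem finrank_eq_ncard_leadingExponents (m : MonomialOrder σ)
    (W : Submodule K (MvPolynomial σ K)) [FiniteDimensional K W] :
    Module.finrank K W = (leadingExponents m W).ncard := by
  obtain ⟨F, hFW, hF, hdeg⟩ := exists_family_leadingExponents m W
  have hli : LinearIndependent K F := m.linearIndependent_of_degree_injective hF fun u v h =>
    Subtype.ext (by simpa only [hdeg] using h)
  have := (finite_leadingExponents m W).fintype
  have h := finrank_span_eq_card hli
  rwa [m.span_eq_of_degree hFW hF hdeg, ← Nat.card_eq_fintype_card, Nat.card_coe_set_eq] at h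

theorem eq_of_leadingExponents_subset (m : MonomialOrder σ)
    {W W' : Submodule K (MvPolynomial σ K)} [FiniteDimensional K W'] (h : W ≤ W')
    (hm : leadingExponents m W' ⊆ leadingExponents m W) : W = W' := by
  have : FiniteDimensional K W := Submodule.finiteDimensional_of_le h
  refine Submodule.eq_of_le_of_finrank_eq h ?_
  rw [finrank_eq_ncard_leadingExponents m, finrank_eq_ncard_leadingExponents m,
    (leadingExponents_mono m h).antisymm hm]

/-- The exponents of the monomials in the initial ideal. -/
def initialExponents (m : MonomialOrder σ) (J : Ideal (MvPolynomial σ K)) : Set (σ →₀ ℕ) :=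
  {u | monomial u (1 : K) ∈ initialIdeal m J}

theorem mem_initialExponents_of_le {m : MonomialOrder σ} {J : Ideal (MvPolynomial σ K)}
    {u v : σ →₀ ℕ} (hu : u ∈ initialExponents m J) (h : u ≤ v) : v ∈ initialExponents m J := by
  have : monomial v (1 : K) = monomial (v - u) 1 * monomial u 1 := by
    rw [monomial_mul, mul_one, tsub_add_cancel_of_le h]
  unfold initialExponents at *
  rw [Set.mem_ofPred_eq, this]
  exact Ideal.mul_mem_left _ _ hu

theorem initialIdeal_eq_span_monomial (m : MonomialOrder σ) (J : Ideal (MvPolynomial σ K)) :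
    initialIdeal m J =
      Ideal.span ((fun u => monomial u (1 : K)) '' {u | ∃ f ∈ J, f ≠ 0 ∧ m.degree f = u}) := by
  refine le_antisymm (Ideal.span_le.2 ?_) (Ideal.span_le.2 ?_)
  · rintro _ ⟨f, hf, rfl⟩
    by_cases hf0 : f = 0
    · rw [hf0, m.leadingTerm_zero]; exact Ideal.zero_mem _
    · have : m.leadingTerm f = C (m.leadingCoeff f) * monomial (m.degree f) 1 := by
        rw [C_mul_monomial, mul_one]; rfl
      rw [SetLike.mem_coe, this]
      exact Ideal.mul_mem_left _ _ (Ideal.subset_span ⟨_, ⟨f, hf, hf0, rfl⟩, rfl⟩)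
  · rintro _ ⟨_, ⟨f, hf, hf0, rfl⟩, rfl⟩
    have : monomial (m.degree f) (1 : K) = C (m.leadingCoeff f)⁻¹ * m.leadingTerm f := by
      unfold MonomialOrder.leadingTerm
      rw [C_mul_monomial, inv_mul_cancel₀ (m.leadingCoeff_ne_zero_iff.2 hf0)]
    simp only [SetLike.mem_coe, this]
    exact Ideal.mul_mem_left _ _ (Ideal.subset_span ⟨f, hf, rfl⟩)

/-- A monomial of the initial ideal is a multiple of some leading monomial, and the same multiple of
the polynomial realizes it. -/
theorem mem_initialExponents {m : MonomialOrder σ} {J : Ideal (MvPolynomial σ K)} {u : σ →₀ ℕ} :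
    u ∈ initialExponents m J ↔ ∃ f ∈ J, f ≠ 0 ∧ m.degree f = u := by
  constructor
  · intro h
    unfold initialExponents at h
    rw [Set.mem_ofPred_eq, initialIdeal_eq_span_monomial, mem_ideal_span_monomial_image] at h
    obtain ⟨_, ⟨f, hf, hf0, rfl⟩, hle⟩ := h u (by
      classical
      rw [mem_support_iff, coeff_monomial, if_pos rfl]; exact one_ne_zero)
    refine ⟨monomial (u - m.degree f) 1 * f, Ideal.mul_mem_left _ _ hf, mul_ne_zero (by simp) hf0,
      ?_⟩
    classical
    rw [m.degree_mul (by simp) hf0, m.degree_monomial, if_neg one_ne_zero,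
      tsub_add_cancel_of_le hle]
  · rintro ⟨f, hf, hf0, rfl⟩
    unfold initialExponents
    rw [Set.mem_ofPred_eq, initialIdeal_eq_span_monomial]
    exact Ideal.subset_span ⟨_, ⟨f, hf, hf0, rfl⟩, rfl⟩

/-- The forms of degree `d` in `J`. -/
noncomputable def formsOfDegree (J : Ideal (MvPolynomial σ K)) (d : ℕ) :
    Submodule K (MvPolynomial σ K) :=
  J.restrictScalars K ⊓ homogeneousSubmodule σ K d

theorem mem_formsOfDegree {J : Ideal (MvPolynomial σ K)} {d : ℕ} {f : MvPolynomial σ K} :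
    f ∈ formsOfDegree J d ↔ f ∈ J ∧ f.IsHomogeneous d := Iff.rfl

instance [Finite σ] (J : Ideal (MvPolynomial σ K)) (d : ℕ) :
    FiniteDimensional K (formsOfDegree J d) := by
  have : Module.Finite K (homogeneousSubmodule σ K d) :=
    Module.Finite.iff_fg.2 (homogeneousSubmodule_fg σ K d)
  exact Submodule.finiteDimensional_of_le (inf_le_right : _ ≤ homogeneousSubmodule σ K d)

/-- The space spanned by the products of the variables with the forms of degree `d - 1` in `J`. -/
noncomputable def linearMultiples (J : Ideal (MvPolynomial σ K)) (d : ℕ) :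
    Submodule K (MvPolynomial σ K) :=
  Submodule.span K {g | ∃ i e, e + 1 = d ∧ ∃ f ∈ formsOfDegree J e, g = X i * f}

theorem linearMultiples_le (J : Ideal (MvPolynomial σ K)) (d : ℕ) :
    linearMultiples J d ≤ formsOfDegree J d := by
  refine Submodule.span_le.2 ?_
  rintro _ ⟨i, e, rfl, f, hf, rfl⟩
  rw [mem_formsOfDegree] at hf
  refine mem_formsOfDegree.2 ⟨Ideal.mul_mem_left _ _ hf.1, ?_⟩
  rw [add_comm]
  exact (isHomogeneous_X K i).mul hf.2

theorem degree_of_isHomogeneous {m : MonomialOrder σ} {f : MvPolynomial σ K} {d : ℕ}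
    (hf : f.IsHomogeneous d) (hf0 : f ≠ 0) : (m.degree f).degree = d := by
  by_contra h
  exact m.coeff_degree_ne_zero_iff.2 hf0 (hf.coeff_eq_zero h)

/-- The homogeneous component that contains the leading term keeps the leading exponent and stays in
`J`. The order need not be graded. -/
theorem leadingExponents_formsOfDegree (m : MonomialOrder σ) {J : Ideal (MvPolynomial σ K)}
    (hJ : J.IsHomogeneous (homogeneousSubmodule σ K)) (d : ℕ) :
    leadingExponents m (formsOfDegree J d) = {u | u ∈ initialExponents m J ∧ u.degree = d} := by
  ext u
  constructor
  · rintro ⟨f, hf, hf0, rfl⟩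
    rw [mem_formsOfDegree] at hf
    exact ⟨mem_initialExponents.2 ⟨f, hf.1, hf0, rfl⟩, degree_of_isHomogeneous hf.2 hf0⟩
  · rintro ⟨hu, rfl⟩
    obtain ⟨f, hf, hf0, rfl⟩ := mem_initialExponents.1 hu
    set g := homogeneousComponent (m.degree f).degree f with hg
    have hcoeff : coeff (m.degree f) g = coeff (m.degree f) f := by
      rw [hg, coeff_homogeneousComponent, if_pos rfl]
    have hcf : coeff (m.degree f) f ≠ 0 := m.coeff_degree_ne_zero_iff.2 hf0
    have hg0 : g ≠ 0 := fun h => hcf (by rw [← hcoeff, h, coeff_zero])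
    refine ⟨g, mem_formsOfDegree.2 ⟨homogeneousComponent_mem_of_mem hJ hf _,
      homogeneousComponent_isHomogeneous _ _⟩, hg0, m.toSyn.injective (le_antisymm ?_ ?_)⟩
    · refine m.degree_le_iff.2 fun v hv => m.le_degree ?_
      rw [mem_support_iff, hg, coeff_homogeneousComponent] at hv
      exact mem_support_iff.2 fun h => hv (by simp [h])
    · exact m.le_degree (mem_support_iff.2 (hcoeff ▸ hcf))

/-- The exponents of the minimal generators of the initial ideal. -/
def minimalExponents (m : MonomialOrder σ) (J : Ideal (MvPolynomial σ K)) : Set (σ →₀ ℕ) :=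
  {u | u ∈ initialExponents m J ∧ ∀ i, u i ≠ 0 → u - Finsupp.single i 1 ∉ initialExponents m J}

/-- The exponents of degree `d` in the initial ideal which are not minimal. -/
def nonminimalExponents (m : MonomialOrder σ) (J : Ideal (MvPolynomial σ K)) (d : ℕ) :
    Set (σ →₀ ℕ) :=
  {u | u.degree = d ∧ ∃ i, u i ≠ 0 ∧ u - Finsupp.single i 1 ∈ initialExponents m J}

theorem single_one_le {u : σ →₀ ℕ} {i : σ} (h : u i ≠ 0) : Finsupp.single i 1 ≤ u := by
  rw [Finsupp.single_le_iff]
  omega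

theorem degree_sub_single {u : σ →₀ ℕ} {i : σ} (h : u i ≠ 0) :
    (u - Finsupp.single i 1).degree + 1 = u.degree := by
  conv_rhs => rw [← tsub_add_cancel_of_le (single_one_le h), map_add, Finsupp.degree_single]

/-- Multiplying a form by a variable multiplies its leading monomial by that variable. The inclusion
is strict when a cancellation among linear multiples produces a minimal generator of the initial
ideal. -/
theorem nonminimalExponents_subset (m : MonomialOrder σ) {J : Ideal (MvPolynomial σ K)}
    (hJ : J.IsHomogeneous (homogeneousSubmodule σ K)) (d : ℕ) :
    nonminimalExponents m J d ⊆ leadingExponents m (linearMultiples J d) := by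
  rintro u ⟨rfl, i, hi, hu⟩
  have h : u - Finsupp.single i 1 ∈
      leadingExponents m (formsOfDegree J (u - Finsupp.single i 1).degree) := by
    rw [leadingExponents_formsOfDegree m hJ]
    exact ⟨hu, rfl⟩
  obtain ⟨f, hf, hf0, hfu⟩ := h
  refine ⟨X i * f, Submodule.subset_span ⟨i, _, degree_sub_single hi, f, hf, rfl⟩,
    mul_ne_zero (X_ne_zero i) hf0, ?_⟩
  rw [m.degree_mul (X_ne_zero i) hf0, m.degree_X, hfu, add_tsub_cancel_of_le (single_one_le hi)]

theorem eq_of_mem_minimalExponents {m : MonomialOrder σ} {J : Ideal (MvPolynomial σ K)}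
    {u v : σ →₀ ℕ} (hu : u ∈ minimalExponents m J) (hv : v ∈ initialExponents m J) (h : v ≤ u) :
    v = u := by
  by_contra hne
  obtain ⟨i, hi⟩ : ∃ i, v i ≠ u i := by
    by_contra! h0
    exact hne (Finsupp.ext h0)
  have hlt : v i < u i := lt_of_le_of_ne (h i) hi
  refine hu.2 i (by omega) (mem_initialExponents_of_le hv fun j => ?_)
  classical
  rw [Finsupp.tsub_apply, Finsupp.single_apply]
  split_ifs with hij
  · subst hij; omega
  · exact h j

theorem exists_minimalExponents_le {m : MonomialOrder σ} {J : Ideal (MvPolynomial σ K)}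
    {u : σ →₀ ℕ} (hu : u ∈ initialExponents m J) : ∃ v ∈ minimalExponents m J, v ≤ u := by
  induction hd : u.degree generalizing u with
  | zero =>
    refine ⟨u, ⟨hu, fun i hi => ?_⟩, le_rfl⟩
    rw [(Finsupp.degree_eq_zero_iff u).1 hd] at hi
    exact absurd rfl hi
  | succ d ih =>
    by_cases h : ∀ i, u i ≠ 0 → u - Finsupp.single i 1 ∉ initialExponents m J
    · exact ⟨u, ⟨hu, h⟩, le_rfl⟩
    · push Not at h
      obtain ⟨i, hi, hi'⟩ := h
      obtain ⟨v, hv, hvu⟩ := ih hi' (by have := degree_sub_single hi; omega)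
      exact ⟨v, hv, hvu.trans tsub_le_self⟩

end LeadingExponents

/-! ### Counting minimal generators -/

section MinimalGenerators

open MvPolynomial

variable {K : Type*} [Field K] {n : ℕ} {J : Ideal (MvPolynomial (Fin n) K)}
  {S : Finset (MvPolynomial (Fin n) K)}

theorem IsMinimalHomogeneousGenerators.isHomogeneous (hS : IsMinimalHomogeneousGenerators J S) :
    J.IsHomogeneous (homogeneousSubmodule (Fin n) K) := by
  rw [← hS.span_eq]
  exact Ideal.homogeneous_span _ _ fun f hf => hS.homogeneous f hf

theorem IsMinimalHomogeneousGenerators.ne_zero (hS : IsMinimalHomogeneousGenerators J S)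
    {f : MvPolynomial (Fin n) K} (hf : f ∈ S) : f ≠ 0 := by
  rintro rfl
  exact hS.minimal 0 hf (Ideal.zero_mem _)

/-- A form in `J` is generated by the generators of no larger degree. -/
theorem IsMinimalHomogeneousGenerators.mem_span_of_isHomogeneous
    (hS : IsMinimalHomogeneousGenerators J S) {f : MvPolynomial (Fin n) K} {d : ℕ}
    (hf : f ∈ J) (hd : f.IsHomogeneous d) :
    f ∈ Ideal.span {s | s ∈ S ∧ ∃ e ≤ d, s.IsHomogeneous e} := by
  rw [← hS.span_eq] at hf
  obtain ⟨p, -, rfl⟩ := Submodule.mem_span_finset.1 hf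
  rw [← homogeneousComponent_eq_self hd, map_sum]
  refine Ideal.sum_mem _ fun s hs => ?_
  obtain ⟨e, he⟩ := hS.homogeneous s hs
  rw [smul_eq_mul, homogeneousComponent_mul_of_isHomogeneous he]
  split_ifs with h
  · exact Ideal.mul_mem_left _ _ (Ideal.subset_span ⟨hs, e, h, he⟩)
  · exact Ideal.zero_mem _

/-- Forms of degree `d - 1` need only generators of degree below `d`, and `f` is not one of these.
-/
theorem linearMultiples_le_span (hS : IsMinimalHomogeneousGenerators J S) {d : ℕ}
    {f g : MvPolynomial (Fin n) K} (hg : g ∈ linearMultiples J d) (hf : f ∈ S)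
    (hd : f.IsHomogeneous d) : g ∈ Ideal.span ((S : Set (MvPolynomial (Fin n) K)) \ {f}) := by
  induction hg using Submodule.span_induction with
  | mem g hg =>
    obtain ⟨i, e, rfl, g, hg, rfl⟩ := hg
    rw [mem_formsOfDegree] at hg
    refine Ideal.mul_mem_left _ _ (Ideal.span_mono ?_ (hS.mem_span_of_isHomogeneous hg.1 hg.2))
    rintro s ⟨hs, e', he', hse⟩
    refine ⟨hs, ?_⟩
    rintro rfl
    have := hse.inj_right hd (hS.ne_zero hf)
    omega
  | zero => exact Ideal.zero_mem _
  | add x y _ _ hx hy => exact Ideal.add_mem _ hx hy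
  | smul a x _ hx => exact Submodule.smul_of_tower_mem _ a hx

open Classical in
/-- The minimal generators of degree `d` are linearly independent modulo linear multiples of
forms of smaller degree. -/
theorem card_add_finrank_linearMultiples_le (hS : IsMinimalHomogeneousGenerators J S) (d : ℕ) :
    (S.filter fun f => f.IsHomogeneous d).card + Module.finrank K (linearMultiples J d) ≤
      Module.finrank K (formsOfDegree J d) := by
  let T := S.filter fun f => f.IsHomogeneous d
  have : FiniteDimensional K (linearMultiples J d) :=
    Submodule.finiteDimensional_of_le (linearMultiples_le J d)
  have hT (f : T) : f.1 ∈ S ∧ f.1.IsHomogeneous d := Finset.mem_filter.1 f.2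
  have hTJ (f : T) : f.1 ∈ formsOfDegree J d :=
    ⟨by rw [← hS.span_eq]; exact Ideal.subset_span (hT f).1, (hT f).2⟩
  let Φ : (T → K) × linearMultiples J d →ₗ[K] formsOfDegree J d :=
    (Fintype.linearCombination K fun f : T => (⟨f.1, hTJ f⟩ : formsOfDegree J d)).coprod
      (Submodule.inclusion (linearMultiples_le J d))
  have hΦ : Function.Injective Φ := by
    rw [← LinearMap.ker_eq_bot, LinearMap.ker_eq_bot']
    rintro ⟨a, b⟩ hab
    have hab' : ∑ f : T, a f • f.1 + b.1 = 0 := by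
      have := congrArg Subtype.val hab
      simpa [Φ, Fintype.linearCombination_apply] using this
    have ha : a = 0 := by
      by_contra ha
      obtain ⟨f, hf⟩ := Function.ne_iff.1 ha
      refine hS.minimal f.1 (hT f).1 ?_
      have hmem : a f • f.1 ∈ Ideal.span ((S : Set (MvPolynomial (Fin n) K)) \ {f.1}) := by
        rw [← Finset.add_sum_erase _ _ (Finset.mem_univ f), add_assoc] at hab'
        rw [eq_neg_of_add_eq_zero_left hab']
        refine neg_mem (add_mem (sum_mem fun g hg => ?_)
          (linearMultiples_le_span hS b.2 (hT f).1 (hT f).2))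
        refine Submodule.smul_of_tower_mem _ _ (Ideal.subset_span ⟨(hT g).1, fun h => ?_⟩)
        exact (Finset.mem_erase.1 hg).1 (Subtype.ext h)
      have := Submodule.smul_of_tower_mem _ (a f)⁻¹ hmem
      rwa [inv_smul_smul₀ hf] at this
    subst ha
    have hb : b = 0 := Subtype.ext (by simpa using hab')
    rw [hb]
    rfl
  have h := LinearMap.finrank_le_finrank_of_injective hΦ
  rwa [Module.finrank_prod, Module.finrank_fintype_fun_eq_card, Fintype.card_coe] at h

open Classical in
/-- If the initial ideal has at most as many minimal generators as `J`, then it has equally many,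
and `J` has Gröbner bases without elements that are not minimal generators. -/
theorem leadingExponents_linearMultiples_of_card_le (m : MonomialOrder (Fin n))
    (hS : IsMinimalHomogeneousGenerators J S)
    (hM : ∀ F : Finset (Fin n →₀ ℕ), (∀ u ∈ F, u ∈ minimalExponents m J) → F.card ≤ S.card) :
    (∀ d, leadingExponents m (linearMultiples J d) = nonminimalExponents m J d) ∧
      ∃ F : Finset (Fin n →₀ ℕ), (∀ u ∈ F, u ∈ minimalExponents m J) ∧ F.card = S.card := by
  have hJ := hS.isHomogeneous
  have hfin (d : ℕ) : {u | u ∈ minimalExponents m J ∧ u.degree = d}.Finite := by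
    refine (finite_leadingExponents m (formsOfDegree J d)).subset ?_
    rw [leadingExponents_formsOfDegree m hJ]
    exact fun u hu => ⟨hu.1.1, hu.2⟩
  let M (d : ℕ) : Finset (Fin n →₀ ℕ) := (hfin d).toFinset
  have hMmem (d u) : u ∈ M d ↔ u ∈ minimalExponents m J ∧ u.degree = d := by simp [M]
  have hB (d : ℕ) : FiniteDimensional K (linearMultiples J d) :=
    Submodule.finiteDimensional_of_le (linearMultiples_le J d)
  have hV (d : ℕ) : Module.finrank K (formsOfDegree J d) =
      (nonminimalExponents m J d).ncard + (M d).card := by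
    have hfinQ : (nonminimalExponents m J d).Finite :=
      (finite_leadingExponents m _).subset (nonminimalExponents_subset m hJ d)
    rw [finrank_eq_ncard_leadingExponents m, ← Set.ncard_coe_finset,
      ← Set.ncard_union_eq ?_ hfinQ (Finset.finite_toSet _)]
    · congr 1
      rw [leadingExponents_formsOfDegree m hJ]
      ext u
      rw [Set.mem_union, Finset.mem_coe, hMmem]
      constructor
      · rintro ⟨hu, rfl⟩
        by_cases h : ∀ i, u i ≠ 0 → u - Finsupp.single i 1 ∉ initialExponents m J
        · exact Or.inr ⟨⟨hu, h⟩, rfl⟩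
        · push Not at h
          exact Or.inl ⟨rfl, h⟩
      · rintro (⟨rfl, i, hi, h⟩ | ⟨h, rfl⟩)
        · exact ⟨mem_initialExponents_of_le h tsub_le_self, rfl⟩
        · exact ⟨h.1, rfl⟩
    · rw [Set.disjoint_left]
      rintro u ⟨-, i, hi, h⟩ hu
      rw [Finset.mem_coe, hMmem] at hu
      exact hu.1.2 i hi h
  have hQ (d : ℕ) : (nonminimalExponents m J d).ncard ≤
      (leadingExponents m (linearMultiples J d)).ncard :=
    Set.ncard_le_ncard (nonminimalExponents_subset m hJ d) (finite_leadingExponents m _)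
  -- The generators of degree `d` are independent modulo the linear multiples, whose dimension is at
  -- least the number of nonminimal exponents; by `hV` this leaves room for at most `(M d).card` of
  -- them.
  have hle (d : ℕ) : (S.filter fun f => f.IsHomogeneous d).card ≤ (M d).card := by
    have h1 := card_add_finrank_linearMultiples_le hS d
    have h2 := hQ d
    rw [hV, finrank_eq_ncard_leadingExponents m] at h1
    omega
  choose! deg hdeg using hS.homogeneous
  have hdeg' (d f) (hf : f ∈ S) : f.IsHomogeneous d ↔ deg f = d :=
    ⟨fun h => (hdeg f hf).inj_right h (hS.ne_zero hf), fun h => h ▸ hdeg f hf⟩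
  have hsumS (N : ℕ) (hN : ∀ f ∈ S, deg f ≤ N) :
      S.card = ∑ d ∈ Finset.range (N + 1), (S.filter fun f => f.IsHomogeneous d).card := by
    rw [Finset.card_eq_sum_card_fiberwise (f := deg) (t := Finset.range (N + 1))
      fun f hf => by simpa [Nat.lt_succ_iff] using hN f hf]
    refine Finset.sum_congr rfl fun d _ => congrArg _ (Finset.filter_congr fun f hf => ?_)
    rw [hdeg' d f hf]
  have hdisj (N : ℕ) : ((Finset.range (N + 1)).biUnion M).card =
      ∑ d ∈ Finset.range (N + 1), (M d).card := by
    refine Finset.card_biUnion fun d _ e _ hde => ?_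
    refine Finset.disjoint_left.2 fun u hu hu' => ?_
    rw [hMmem] at hu hu'
    exact hde (hu.2.symm.trans hu'.2)
  have hmem (N u) (hu : u ∈ (Finset.range (N + 1)).biUnion M) : u ∈ minimalExponents m J := by
    obtain ⟨d, -, hd⟩ := Finset.mem_biUnion.1 hu
    exact ((hMmem d u).1 hd).1
  have heq (N : ℕ) (hN : ∀ f ∈ S, deg f ≤ N) :
      S.card = ∑ d ∈ Finset.range (N + 1), (M d).card := by
    refine le_antisymm ?_ (hdisj N ▸ hM _ (hmem N))
    rw [hsumS N hN]
    exact Finset.sum_le_sum fun d _ => hle d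
  refine ⟨fun d => ?_, _, hmem (S.sup deg), ?_⟩
  -- The termwise inequalities `hle` have equal sums, so each is an equality. The set of nonminimal
  -- exponents then has as many elements as the set of leading exponents containing it.
  · let N := max d (S.sup deg)
    have hN : ∀ f ∈ S, deg f ≤ N := fun f hf => (Finset.le_sup hf).trans (le_max_right _ _)
    have h0 := (Finset.sum_eq_sum_iff_of_le fun d _ => hle d).1
      ((hsumS N hN).symm.trans (heq N hN)) d (Finset.mem_range_succ_iff.2 (le_max_left _ _))
    have h1 := card_add_finrank_linearMultiples_le hS d
    rw [hV, finrank_eq_ncard_leadingExponents m] at h1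
    exact (Set.eq_of_subset_of_ncard_le (nonminimalExponents_subset m hJ d) (by omega)
      (finite_leadingExponents m _)).symm
  · rw [hdisj, ← heq _ fun f hf => Finset.le_sup hf]

end MinimalGenerators

/-! ### Ideals with stable initial ideal -/

section StableInitialIdeal

open MvPolynomial

/-- The largest rank of a variable occurring in an exponent vector. -/
def exponentClass {σ : Type*} (ρ : σ → ℕ) (u : σ →₀ ℕ) : ℕ := u.support.sup ρ

theorem rank_le_exponentClass {σ : Type*} (ρ : σ → ℕ) {u : σ →₀ ℕ} {i : σ} (h : u i ≠ 0) :
    ρ i ≤ exponentClass ρ u :=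
  Finset.le_sup (Finsupp.mem_support_iff.2 h)

theorem eq_of_le_of_degree_eq {σ : Type*} {u v : σ →₀ ℕ} (h : u ≤ v)
    (hd : u.degree = v.degree) : u = v := by
  have h1 := add_tsub_cancel_of_le h
  have h2 : (v - u).degree = 0 := by
    rw [← h1, map_add] at hd
    omega
  rw [(Finsupp.degree_eq_zero_iff _).1 h2, add_zero] at h1
  exact h1

/-- An exponent vector has at most one initial segment of given degree. -/
theorem eq_of_add_eq_add_of_mem_tailExponents {σ : Type*} {ρ : σ → ℕ} (hρ : Function.Injective ρ)
    {a b u v : σ →₀ ℕ} (ha : a ∈ tailExponents ρ (exponentClass ρ u))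
    (hb : b ∈ tailExponents ρ (exponentClass ρ v)) (h : a + u = b + v)
    (hd : u.degree = v.degree) : u = v := by
  wlog huv : exponentClass ρ u ≤ exponentClass ρ v generalizing a b u v
  · exact (this hb ha h.symm hd.symm (by omega)).symm
  have hy (y) : a y + u y = b y + v y := DFunLike.congr_fun h y
  have hu (y) (h1 : exponentClass ρ u < ρ y) : u y = 0 := by
    by_contra h2
    have := rank_le_exponentClass ρ h2
    omega
  have hv (y) (h1 : exponentClass ρ v < ρ y) : v y = 0 := by
    by_contra h2
    have := rank_le_exponentClass ρ h2
    omega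
  have ha' (y) (h1 : ρ y < exponentClass ρ u) : a y = 0 := by
    by_contra h2
    have := ha y h2
    omega
  have hb' (y) (h1 : ρ y < exponentClass ρ v) : b y = 0 := by
    by_contra h2
    have := hb y h2
    omega
  -- Below the class of `v` the cofactor `b` vanishes, so `v = a + u ≥ u` there; above it `u`
  -- vanishes. Only the variable at the class itself can obstruct `u ≤ v`.
  have key (h1 : ∀ y, ρ y = exponentClass ρ v → u y ≤ v y) : u = v := by
    refine eq_of_le_of_degree_eq (fun y => ?_) hd
    rcases lt_trichotomy (ρ y) (exponentClass ρ v) with h2 | h2 | h2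
    · have := hy y
      have := hb' y h2
      omega
    · exact h1 y h2
    · rw [hu y (by omega)]
      exact Nat.zero_le _
  rcases huv.lt_or_eq with hlt | heq
  · refine key fun y h1 => ?_
    rw [hu y (by omega)]
    exact Nat.zero_le _
  by_cases hex : ∃ y, ρ y = exponentClass ρ v ∧ v y < u y
  · obtain ⟨z, hz, hlt⟩ := hex
    refine (eq_of_le_of_degree_eq (fun y => ?_) hd.symm).symm
    rcases lt_trichotomy (ρ y) (exponentClass ρ v) with h2 | h2 | h2
    · have := hy y
      have := hb' y h2
      have := ha' y (by omega)
      omega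
    · rw [hρ (h2.trans hz.symm)]
      exact hlt.le
    · rw [hv y h2]
      exact Nat.zero_le _
  · push Not at hex
    exact key hex

variable {K : Type*} [Field K] {n : ℕ} {J : Ideal (MvPolynomial (Fin n) K)}

/-- If the initial ideal of `J` is stable with respect to some ranking of the variables and has no
more minimal generators in any degree than `J`, then `J` is componentwise linear. -/
theorem isComponentwiseLinear_of_stable (m : MonomialOrder (Fin n))
    (hJ : J.IsHomogeneous (homogeneousSubmodule (Fin n) K))
    (hlin : ∀ d, leadingExponents m (linearMultiples J d) = nonminimalExponents m J d)
    {ρ : Fin n → ℕ} (hρ : Function.Injective ρ)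
    (hst : ∀ u ∈ initialExponents m J, ∀ i z, u z ≠ 0 → (∀ y, u y ≠ 0 → ρ y ≤ ρ z) → ρ i < ρ z →
      u - Finsupp.single z 1 + Finsupp.single i 1 ∈ initialExponents m J) :
    IsComponentwiseLinear J := by
  classical
  intro k
  obtain ⟨F, hFW, hF, hFdeg⟩ := exists_family_leadingExponents m (formsOfDegree J k)
  have := (finite_leadingExponents m (formsOfDegree J k)).fintype
  let e := Fintype.equivFin (leadingExponents m (formsOfDegree J k))
  let u : Fin _ → (Fin n →₀ ℕ) := fun j => (e.symm j).1
  let ε : Fin _ → MvPolynomial (Fin n) K := fun j => F (e.symm j)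
  have hu_inj : Function.Injective u := Subtype.val_injective.comp e.symm.injective
  have hεdeg (j) : m.degree (ε j) = u j := hFdeg _
  have hε0 (j) : ε j ≠ 0 := hF _
  have hεhom (j) : (ε j).IsHomogeneous k := (hFW _).2
  have hudeg (j) : (u j).degree = k := by
    rw [← hεdeg]
    exact degree_of_isHomogeneous (hεhom j) (hε0 j)
  have hu_surj (v) (hv : v ∈ initialExponents m J) (hvk : v.degree = k) : ∃ j, u j = v := by
    have : v ∈ leadingExponents m (formsOfDegree J k) := by
      rw [leadingExponents_formsOfDegree m hJ]
      exact ⟨hv, hvk⟩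
    exact ⟨e ⟨v, this⟩, by simp [u]⟩
  have hspan : Ideal.span (Set.range ε) = degreeComponentIdeal J k := by
    refine le_antisymm (Ideal.span_mono ?_) (Ideal.span_le.2 fun f hf => ?_)
    · rintro _ ⟨j, rfl⟩
      exact mem_formsOfDegree.1 (hFW _)
    · have h1 : f ∈ Submodule.span K (Set.range F) := by
        rw [m.span_eq_of_degree hFW hF hFdeg]
        exact hf
      have h2 : Set.range F = Set.range ε := (e.symm.surjective.range_comp F).symm
      rw [h2] at h1
      exact Submodule.span_le_restrictScalars K _ _ h1
  rw [← hspan]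
  refine IsPommaretBasis.hasLinearResolution hρ (c := fun j => exponentClass ρ (u j))
    ⟨fun q hq h0 => ?_, fun j i _ => ?_⟩ hεhom
  -- By uniqueness of initial segments the nonzero products have distinct leading exponents, so they
  -- cannot cancel.
  · by_contra hne
    obtain ⟨j₀, hj₀⟩ := Function.ne_iff.1 hne
    have hdeg (j) (hj : q j ≠ 0) : m.degree (q j • ε j) = m.degree (q j) + u j := by
      rw [smul_eq_mul, m.degree_mul hj (hε0 j), hεdeg]
    have htail (j) (hj : q j ≠ 0) : m.degree (q j) ∈ tailExponents ρ (exponentClass ρ (u j)) :=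
      mem_tailPolynomials.1 (hq j) _ (m.coeff_degree_ne_zero_iff.2 hj)
    refine m.sum_ne_zero_of_degree_injOn (s := Finset.univ.filter fun j => q j ≠ 0)
      (f := fun j => q j • ε j) ⟨j₀, by simpa using hj₀⟩
      (fun j hj => smul_ne_zero (Finset.mem_filter.1 hj).2 (hε0 j)) (fun j hj l hl h => ?_) ?_
    · have hj' : q j ≠ 0 := (Finset.mem_filter.1 hj).2
      have hl' : q l ≠ 0 := (Finset.mem_filter.1 hl).2
      have h' : m.degree (q j) + u j = m.degree (q l) + u l := by
        rw [← hdeg j hj', ← hdeg l hl']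
        exact h
      exact hu_inj (eq_of_add_eq_add_of_mem_tailExponents hρ (htail j hj') (htail l hl') h'
        ((hudeg j).trans (hudeg l).symm))
    · rw [Finset.sum_filter_of_ne, h0]
      intro j _ hj hqj
      exact hj (by rw [hqj, zero_smul])
  -- `W` is spanned by the products allowed in a normal form. It realizes all leading exponents of
  -- the linear multiples, hence equals that space and contains every `X i * ε j`.
  · let W : Submodule K (MvPolynomial (Fin n) K) :=
      Submodule.span K {g | ∃ l i, exponentClass ρ (u l) ≤ ρ i ∧ g = X i * ε l}
    have : FiniteDimensional K (linearMultiples J (k + 1)) :=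
      Submodule.finiteDimensional_of_le (linearMultiples_le J (k + 1))
    have hle : W ≤ linearMultiples J (k + 1) := by
      refine Submodule.span_le.2 ?_
      rintro _ ⟨l, i, -, rfl⟩
      exact Submodule.subset_span ⟨i, k, rfl, _, hFW _, rfl⟩
    have hWlead (v) (hv : v ∈ initialExponents m J) (hvk : v.degree = k) (z)
        (hz : exponentClass ρ v ≤ ρ z) : v + Finsupp.single z 1 ∈ leadingExponents m W := by
      obtain ⟨l, rfl⟩ := hu_surj v hv hvk
      refine ⟨X z * ε l, Submodule.subset_span ⟨l, z, hz, rfl⟩,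
        mul_ne_zero (X_ne_zero z) (hε0 l), ?_⟩
      rw [m.degree_mul (X_ne_zero z) (hε0 l), m.degree_X, hεdeg, add_comm]
    have hW : W = linearMultiples J (k + 1) := by
      refine eq_of_leadingExponents_subset m hle ?_
      rw [hlin]
      rintro w ⟨hwk, i, hi, hwi⟩
      have hk := degree_sub_single hi
      have hw : w - Finsupp.single i 1 + Finsupp.single i 1 = w :=
        tsub_add_cancel_of_le (single_one_le hi)
      set v := w - Finsupp.single i 1 with hv
      by_cases hc : exponentClass ρ v ≤ ρ i
      · rw [← hw]
        exact hWlead v hwi (by omega) i hc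
      -- If `i` ranks below the last variable `z` of `v`, stability exchanges `z` for `i` in `v`.
      -- Multiplying the result by `z` is allowed and again gives `w`.
      · obtain ⟨z, hz, hzc⟩ := Finset.exists_mem_eq_sup v.support (by
          by_contra h0
          rw [Finset.not_nonempty_iff_eq_empty] at h0
          simp [exponentClass, h0] at hc) ρ
        rw [Finsupp.mem_support_iff] at hz
        have hzi : z ≠ i := by
          rintro rfl
          exact hc hzc.le
        have hmem := hst v hwi i z hz (fun y hy => hzc ▸ rank_le_exponentClass ρ hy)
          (by rw [← hzc]; exact not_le.1 hc)
        have hk' := degree_sub_single hz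
        have hvz : v - Finsupp.single z 1 + Finsupp.single z 1 = v :=
          tsub_add_cancel_of_le (single_one_le hz)
        have hw' : v - Finsupp.single z 1 + Finsupp.single i 1 + Finsupp.single z 1 = w := by
          rw [add_right_comm, hvz, hw]
        rw [← hw']
        refine hWlead _ hmem (by rw [map_add, Finsupp.degree_single]; omega) z ?_
        refine Finset.sup_le fun y hy => ?_
        rw [Finsupp.mem_support_iff, Finsupp.add_apply, Finsupp.tsub_apply] at hy
        by_cases hyi : y = i
        · subst hyi
          rw [← hzc]
          exact (not_le.1 hc).le
        · rw [Finsupp.single_eq_of_ne hyi] at hy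
          rw [← hzc]
          exact rank_le_exponentClass ρ (by omega)
    have hmem : X i * ε j ∈ W := by
      rw [hW]
      exact Submodule.subset_span ⟨i, k, rfl, _, hFW _, rfl⟩
    rw [smul_eq_mul]
    generalize X i * ε j = g at hmem ⊢
    induction hmem using Submodule.span_induction with
    | mem g hg =>
      obtain ⟨l, i, hi, rfl⟩ := hg
      refine ⟨Pi.single l (X i), fun l' => ?_, fun l' => ?_, ?_⟩
      · by_cases h : l' = l
        · subst h
          rw [Pi.single_eq_same]
          exact X_mem_tailPolynomials hi
        · rw [Pi.single_eq_of_ne h]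
          exact Submodule.zero_mem _
      · by_cases h : l' = l
        · subst h
          rw [Pi.single_eq_same]
          exact isHomogeneous_X K i
        · rw [Pi.single_eq_of_ne h]
          exact isHomogeneous_zero _ _ _
      · rw [Finset.sum_eq_single l (fun l' _ h => by rw [Pi.single_eq_of_ne h, zero_smul])
          (fun h => absurd (Finset.mem_univ _) h), Pi.single_eq_same, smul_eq_mul]
    | zero =>
      exact ⟨0, fun l => Submodule.zero_mem _, fun l => isHomogeneous_zero _ _ _, by simp⟩
    | add x y _ _ hx hy =>
      obtain ⟨p, hp1, hp2, rfl⟩ := hx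
      obtain ⟨q, hq1, hq2, rfl⟩ := hy
      exact ⟨p + q, fun l => Submodule.add_mem _ (hp1 l) (hq1 l),
        fun l => (hp2 l).add (hq2 l), by simp [add_mul, Finset.sum_add_distrib]⟩
    | smul a x _ hx =>
      obtain ⟨p, hp1, hp2, rfl⟩ := hx
      refine ⟨a • p, fun l => Submodule.smul_mem _ a (hp1 l),
        fun l => (homogeneousSubmodule (Fin n) K 1).smul_mem a (hp2 l), ?_⟩
      rw [Finset.smul_sum]
      simp only [Pi.smul_apply, smul_assoc]

end StableInitialIdeal

/-! ### Generic coordinates -/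

section GenericCoordinates

open MvPolynomial

variable {K : Type*} [Field K]

theorem isGenericInitialIdeal_exists_invertible [Infinite K] {n : ℕ}
    {J G : Ideal (MvPolynomial (Fin n) K)} (hG : IsGenericInitialIdeal J G)
    {Q : MvPolynomial (Fin n × Fin n) K} (hQ : Q ≠ 0) :
    ∃ g : GL (Fin n) K, eval (fun p : Fin n × Fin n => g.val p.1 p.2) Q ≠ 0 ∧
      initialIdeal (degRevLex n) (J.map (linearChange g.val)) = G := by
  obtain ⟨P, hP, h⟩ := hG
  have hne : P * Q * (Matrix.mvPolynomialX (Fin n) (Fin n) K).det ≠ 0 :=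
    mul_ne_zero (mul_ne_zero hP hQ) (Matrix.det_mvPolynomialX_ne_zero (Fin n) K)
  obtain ⟨v, hv⟩ : ∃ v, eval v (P * Q * (Matrix.mvPolynomialX (Fin n) (Fin n) K).det) ≠ 0 := by
    by_contra! hcon
    exact hne (MvPolynomial.funext fun v => by rw [hcon v, map_zero])
  rw [map_mul, map_mul] at hv
  have hdet : (Matrix.of fun i j => v (i, j)).det ≠ 0 := by
    intro h0
    refine hv ?_
    have : (eval v).mapMatrix (Matrix.mvPolynomialX (Fin n) (Fin n) K) =
        Matrix.of fun i j => v (i, j) := by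
      ext i j
      simp [Matrix.mvPolynomialX]
    rw [RingHom.map_det, this, h0, mul_zero]
  exact ⟨Matrix.GeneralLinearGroup.mkOfDetNeZero _ hdet,
    right_ne_zero_of_mul (left_ne_zero_of_mul hv), h _ (left_ne_zero_of_mul (left_ne_zero_of_mul hv))⟩

/-- The exponent vector `(d, 0, …, 0)` is the largest one of degree `d`. -/
theorem degRevLex_le_single {n d : ℕ} {u : Fin (n + 1) →₀ ℕ} (hu : u.degree = d) :
    (degRevLex (n + 1)).toSyn u ≤ (degRevLex (n + 1)).toSyn (Finsupp.single 0 d) := by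
  refine not_lt.1 fun h => ?_
  rcases (DegRevLex.of_lt_of_iff (Finsupp.single 0 d) u).1 h with h | ⟨-, i, hne, hi⟩
  · rw [Finsupp.degree_single, hu] at h
    exact lt_irrefl _ h
  · obtain rfl : i = 0 := by
      by_contra h0
      rw [Finsupp.single_eq_of_ne h0] at hi
      omega
    have hu0 : u = Finsupp.single 0 (u 0) := by
      ext j
      by_cases hj : j = 0
      · rw [hj, Finsupp.single_eq_same]
      · rw [Finsupp.single_eq_of_ne hj, ← hne j (Fin.pos_of_ne_zero hj),
          Finsupp.single_eq_of_ne hj]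
    rw [hu0, Finsupp.degree_single] at hu
    rw [Finsupp.single_eq_same] at hi
    omega

/-- Evaluating the transformed form at `(1, 0, …, 0)` isolates its coefficient of `x₁ᵈ` and amounts
to evaluating `f` at the first row of `g`. -/
theorem degree_linearChange_eq_single {n d : ℕ} {f : MvPolynomial (Fin (n + 1)) K}
    (hf : f.IsHomogeneous d) {g : Matrix (Fin (n + 1)) (Fin (n + 1)) K}
    (h : eval (g 0) f ≠ 0) :
    linearChange g f ≠ 0 ∧ (degRevLex (n + 1)).degree (linearChange g f) = Finsupp.single 0 d := by
  have hev : eval (Pi.single 0 1 : Fin (n + 1) → K) (linearChange g f) = eval (g 0) f := by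
    unfold linearChange
    rw [← aeval_eq_eval, ← aeval_eq_eval]
    change ((aeval (Pi.single 0 1 : Fin (n + 1) → K)).comp (aeval fun j =>
      ∑ i, C (g i j) * X i)) f = _
    congr 1
    refine MvPolynomial.algHom_ext fun j => ?_
    simp [Pi.single_apply]
  have hhom := linearChange_isHomogeneous g hf
  rw [← hev, eval_eq] at h
  obtain ⟨u, hu, hu0⟩ := Finset.exists_ne_zero_of_sum_ne_zero h
  have hud : u.degree = d := by
    by_contra h1
    exact mem_support_iff.1 hu (hhom.coeff_eq_zero h1)
  obtain rfl : u = Finsupp.single 0 d := by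
    have h1 : u = Finsupp.single 0 (u 0) := by
      ext i
      by_cases hi : i = 0
      · subst hi; simp
      · rw [Finsupp.single_eq_of_ne hi]
        by_contra h2
        refine hu0 (mul_eq_zero_of_right _
          (Finset.prod_eq_zero (Finsupp.mem_support_iff.2 h2) ?_))
        rw [Pi.single_eq_of_ne hi, zero_pow h2]
    rw [h1, Finsupp.degree_single] at hud
    rw [h1, hud]
  refine ⟨fun h1 => by simp [h1] at hu, ?_⟩
  refine (degRevLex (n + 1)).toSyn.injective (le_antisymm ?_ ((degRevLex (n + 1)).le_degree hu))
  refine (degRevLex (n + 1)).degree_le_iff.2 fun v hv => degRevLex_le_single ?_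
  by_contra h1
  exact mem_support_iff.1 hv (hhom.coeff_eq_zero h1)

/-- Generically, the initial ideal contains the power `x₁ᵈ`. -/
theorem exists_linearChange_single_mem [Infinite K] {n d : ℕ}
    {J G : Ideal (MvPolynomial (Fin n) K)} (hG : IsGenericInitialIdeal J G)
    {f : MvPolynomial (Fin n) K} (hf : f ∈ J) (hf0 : f ≠ 0) (hd : f.IsHomogeneous d) :
    ∃ g : GL (Fin n) K, initialIdeal (degRevLex n) (J.map (linearChange g.val)) = G ∧
      ∃ u ∈ initialExponents (degRevLex n) (J.map (linearChange g.val)),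
        u.degree = d ∧ ∀ i : Fin n, i.val ≠ 0 → u i = 0 := by
  cases n with
  | zero =>
    obtain ⟨g, -, hg⟩ := isGenericInitialIdeal_exists_invertible hG one_ne_zero
    refine ⟨g, hg, (degRevLex 0).degree (linearChange g.val f), mem_initialExponents.2
      ⟨_, Ideal.mem_map_of_mem _ hf, ?_, rfl⟩, ?_, fun i => i.elim0⟩
    · exact (map_ne_zero_iff _ (linearChangeEquiv g).injective).2 hf0
    · exact degree_of_isHomogeneous (linearChange_isHomogeneous _ hd)
        ((map_ne_zero_iff _ (linearChangeEquiv g).injective).2 hf0)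
  | succ n =>
    have hinj : Function.Injective fun j : Fin (n + 1) => ((0 : Fin (n + 1)), j) := fun i j h =>
      (Prod.ext_iff.1 h).2
    -- The genericity condition is `f` itself, with its variables renamed to the matrix entries of
    -- the first row.
    obtain ⟨g, hg, hgG⟩ := isGenericInitialIdeal_exists_invertible hG
      ((map_ne_zero_iff _ (rename_injective _ hinj)).2 hf0)
    rw [eval_rename] at hg
    obtain ⟨h1, h2⟩ := degree_linearChange_eq_single hd (g := g.val) hg
    refine ⟨g, hgG, _, mem_initialExponents.2 ⟨_, Ideal.mem_map_of_mem _ hf, h1, h2⟩,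
      Finsupp.degree_single _ _, fun i hi => Finsupp.single_eq_of_ne fun h => hi ?_⟩
    rw [h, Fin.val_zero]

end GenericCoordinates

/-! ### Initial ideals generated in two variables -/

section TwoVariables

open MvPolynomial

variable {K : Type*} [Field K] {n : ℕ}

/-- If the initial ideal is generated in the variables from `V`, then its minimal monomial
generators involve only these variables. -/
theorem eq_zero_of_mem_minimalExponents {m : MonomialOrder (Fin n)}
    {J : Ideal (MvPolynomial (Fin n) K)} {V : Finset (Fin n)} {T : Set (MvPolynomial (Fin n) K)}
    (hT : ∀ f ∈ T, f.vars ⊆ V) (hspan : Ideal.span T = initialIdeal m J) {u : Fin n →₀ ℕ}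
    (hu : u ∈ minimalExponents m J) {i : Fin n} (hi : i ∉ V) : u i = 0 := by
  classical
  -- Setting the variables outside `V` to `1` fixes the generators in `T`, so it preserves the
  -- ideal. It sends a monomial to its `V`-part, which divides it; for a minimal generator the two
  -- must agree.
  let φ : MvPolynomial (Fin n) K →ₐ[K] MvPolynomial (Fin n) K :=
    aeval fun j => if j ∈ V then X j else 1
  have hφT : ∀ f ∈ T, φ f = f := by
    intro f hf
    refine hom_congr_vars (f₁ := φ.toRingHom) (f₂ := RingHom.id _) ?_ (fun i hi _ => ?_) rfl
    · ext a
      simp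
    · simp [φ, hT f hf hi]
  have hφ : initialIdeal m J ≤ (initialIdeal m J).comap φ := by
    rw [← hspan, Ideal.span_le]
    intro f hf
    rw [SetLike.mem_coe, Ideal.mem_comap, hφT f hf]
    exact Ideal.subset_span hf
  have hfil : φ (monomial u 1) = monomial (u.filter (· ∈ V)) 1 := by
    rw [aeval_monomial, map_one, monomial_eq, C_1, Finsupp.prod_fintype _ _ (fun _ => pow_zero _),
      Finsupp.prod_fintype _ _ (fun _ => pow_zero _)]
    congr 1
    refine Finset.prod_congr rfl fun j _ => ?_
    rw [Finsupp.filter_apply]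
    split_ifs <;> simp
  have hmem : u.filter (· ∈ V) ∈ initialExponents m J := by
    have : φ (monomial u 1) ∈ initialIdeal m J := hφ hu.1
    rwa [hfil] at this
  have hle : u.filter (· ∈ V) ≤ u := fun j => by
    rw [Finsupp.filter_apply]
    split_ifs
    · exact le_rfl
    · exact Nat.zero_le _
  rw [← eq_of_mem_minimalExponents hu hmem hle, Finsupp.filter_apply, if_neg hi]

/-- If `x₁` is not in `V`, the minimal generator dividing `x₁ᵈ` can only be `1`, so it is the only
one and any `b` works. -/
theorem exists_other_variable {m : MonomialOrder (Fin (n + 1))}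
    {J : Ideal (MvPolynomial (Fin (n + 1)) K)} {V : Finset (Fin (n + 1))} (hV : V.card ≤ 2)
    (hsupp : ∀ u ∈ minimalExponents m J, ∀ i ∉ V, u i = 0) {d : ℕ}
    (hd : Finsupp.single 0 d ∈ initialExponents m J) :
    ∃ b, ∀ u ∈ minimalExponents m J, ∀ i, i ≠ 0 → i ≠ b → u i = 0 := by
  by_cases h0 : 0 ∈ V
  · have hcard : (V.erase 0).card ≤ 1 := by
      rw [Finset.card_erase_of_mem h0]
      omega
    rw [Finset.card_le_one_iff_subset_singleton] at hcard
    obtain ⟨b, hb⟩ := hcard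
    refine ⟨b, fun u hu i hi hib => hsupp u hu i fun hiV => hib ?_⟩
    exact Finset.mem_singleton.1 (hb (Finset.mem_erase.2 ⟨hi, hiV⟩))
  · obtain ⟨v, hv, hvd⟩ := exists_minimalExponents_le hd
    have hv0 : v = 0 := by
      ext i
      by_cases hi : i = 0
      · subst hi
        exact hsupp v hv 0 h0
      · have := hvd i
        rw [Finsupp.single_eq_of_ne hi] at this
        exact Nat.le_zero.1 this
    subst hv0
    refine ⟨0, fun u hu i _ _ => ?_⟩
    rw [← eq_of_mem_minimalExponents hu hv.1 zero_le, Finsupp.zero_apply]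

/-- Monomials in `x₁` and `x_b` with equal `x₁`-exponent are comparable under divisibility. -/
theorem eq_of_apply_zero_eq {m : MonomialOrder (Fin (n + 1))}
    {J : Ideal (MvPolynomial (Fin (n + 1)) K)} {b : Fin (n + 1)}
    (hb : ∀ u ∈ minimalExponents m J, ∀ i, i ≠ 0 → i ≠ b → u i = 0) {u v : Fin (n + 1) →₀ ℕ}
    (hu : u ∈ minimalExponents m J) (hv : v ∈ minimalExponents m J) (h : u 0 = v 0) : u = v := by
  wlog hle : u b ≤ v b generalizing u v
  · exact (this hv hu h.symm (by omega)).symm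
  refine eq_of_mem_minimalExponents hv hu.1 fun i => ?_
  by_cases hi : i = 0
  · rw [hi, h]
  · by_cases hib : i = b
    · rw [hib]; exact hle
    · rw [hb u hu i hi hib]; exact Nat.zero_le _

theorem apply_zero_le_of_mem_minimalExponents {m : MonomialOrder (Fin (n + 1))}
    {J : Ideal (MvPolynomial (Fin (n + 1)) K)} {d : ℕ}
    (hd : Finsupp.single 0 d ∈ initialExponents m J) {u : Fin (n + 1) →₀ ℕ}
    (hu : u ∈ minimalExponents m J) : u 0 ≤ d := by
  by_contra h
  have h1 := eq_of_mem_minimalExponents hu hd (by rw [Finsupp.single_le_iff]; omega)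
  rw [← h1, Finsupp.single_eq_same] at h
  exact h le_rfl

/-- An ideal with initial ideal generated in two variables and containing `x₁ᵈ` has at most `d + 1`
minimal monomial generators in its initial ideal. -/
theorem card_minimalExponents_le {m : MonomialOrder (Fin n)} {J : Ideal (MvPolynomial (Fin n) K)}
    {V : Finset (Fin n)} (hV : V.card ≤ 2)
    (hsupp : ∀ u ∈ minimalExponents m J, ∀ i ∉ V, u i = 0) {a : Fin n →₀ ℕ}
    (ha : a ∈ initialExponents m J) (ha0 : ∀ i : Fin n, i.val ≠ 0 → a i = 0)
    (F : Finset (Fin n →₀ ℕ)) (hF : ∀ u ∈ F, u ∈ minimalExponents m J) :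
    F.card ≤ a.degree + 1 := by
  cases n with
  | zero => exact (Finset.card_le_one.2 fun u _ v _ => Subsingleton.elim u v).trans (by omega)
  | succ n =>
    obtain ⟨d, rfl⟩ : ∃ d, a = Finsupp.single 0 d := by
      refine ⟨a 0, ?_⟩
      ext i
      by_cases hi : i = 0
      · rw [hi, Finsupp.single_eq_same]
      · rw [Finsupp.single_eq_of_ne hi, ha0 i (Fin.val_ne_zero_iff.2 hi)]
    obtain ⟨b, hb⟩ := exists_other_variable hV hsupp ha
    rw [Finsupp.degree_single, ← Finset.card_range (d + 1)]
    refine Finset.card_le_card_of_injOn (fun u => u 0) (fun u hu => ?_) fun u hu v hv h =>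
      eq_of_apply_zero_eq hb (hF u hu) (hF v hv) h
    rw [Finset.mem_coe, Finset.mem_range_succ_iff]
    exact apply_zero_le_of_mem_minimalExponents ha (hF u hu)

/-- If the initial ideal is generated in two variables and contains `x₁ᵈ`, and if it has `d + 1`
minimal monomial generators, then it is stable with respect to some ranking of the variables. -/
theorem exists_stable_ranking {m : MonomialOrder (Fin n)} {J : Ideal (MvPolynomial (Fin n) K)}
    {V : Finset (Fin n)} (hV : V.card ≤ 2)
    (hsupp : ∀ u ∈ minimalExponents m J, ∀ i ∉ V, u i = 0) {a : Fin n →₀ ℕ}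
    (ha : a ∈ initialExponents m J) (ha0 : ∀ i : Fin n, i.val ≠ 0 → a i = 0)
    {F : Finset (Fin n →₀ ℕ)} (hF : ∀ u ∈ F, u ∈ minimalExponents m J)
    (hcard : F.card = a.degree + 1) :
    ∃ ρ : Fin n → ℕ, Function.Injective ρ ∧
      ∀ u ∈ initialExponents m J, ∀ i z, u z ≠ 0 → (∀ y, u y ≠ 0 → ρ y ≤ ρ z) → ρ i < ρ z →
        u - Finsupp.single z 1 + Finsupp.single i 1 ∈ initialExponents m J := by
  classical
  cases n with
  | zero => exact ⟨fun i => i.val, Fin.val_injective, fun u _ i => i.elim0⟩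
  | succ n =>
    obtain ⟨d, rfl⟩ : ∃ d, a = Finsupp.single 0 d := by
      refine ⟨a 0, ?_⟩
      ext i
      by_cases hi : i = 0
      · rw [hi, Finsupp.single_eq_same]
      · rw [Finsupp.single_eq_of_ne hi, ha0 i (Fin.val_ne_zero_iff.2 hi)]
    obtain ⟨b, hb⟩ := exists_other_variable hV hsupp ha
    rw [Finsupp.degree_single] at hcard
    -- The `x₁`-exponent maps the `d + 1` elements of `F` injectively into `{0, …, d}`, hence onto
    -- it.
    have hsurj (s : ℕ) (hs : s ≤ d) : ∃ v ∈ minimalExponents m J, v 0 = s := by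
      have h1 : F.image (fun u => u 0) = Finset.range (d + 1) := by
        refine Finset.eq_of_subset_of_card_le (fun s hs => ?_) ?_
        · obtain ⟨u, hu, rfl⟩ := Finset.mem_image.1 hs
          exact Finset.mem_range_succ_iff.2 (apply_zero_le_of_mem_minimalExponents ha (hF u hu))
        · rw [Finset.card_range, Finset.card_image_of_injOn fun u hu v hv h =>
            eq_of_apply_zero_eq hb (hF u hu) (hF v hv) h, hcard]
      obtain ⟨v, hv, hvs⟩ := Finset.mem_image.1 (h1 ▸ Finset.mem_range_succ_iff.2 hs)
      exact ⟨v, hF v hv, hvs⟩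
    -- The ranking puts `x₁` first and `x_b` second. The shift by one keeps the other ranks above 1,
    -- and `b = 0` is allowed.
    let ρ : Fin (n + 1) → ℕ := fun i => if i = 0 then 0 else if i = b then 1 else i.val + 1
    have hρ0 : ρ 0 = 0 := if_pos rfl
    have hρb (hb0 : b ≠ 0) : ρ b = 1 := by simp [ρ, hb0]
    have hρ (i) (hi : i ≠ 0) (hib : i ≠ b) : ρ i = i.val + 1 ∧ i.val ≠ 0 := by
      simp [ρ, hi, hib]
    refine ⟨ρ, fun i j hij => ?_, fun u hu i z hz hmax hiz => ?_⟩
    · have hne (k : Fin (n + 1)) (hk : k ≠ 0) : k.val ≠ 0 := Fin.val_ne_zero_iff.2 hk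
      have hi := hne i
      have hj := hne j
      simp only [ρ] at hij
      grind
    · obtain ⟨v, hv, hvu⟩ := exists_minimalExponents_le hu
      by_cases hz0 : z = 0
      · rw [hz0, hρ0] at hiz
        omega
      by_cases hzb : z = b
      · subst hzb
        rw [hρb hz0] at hiz hmax
        obtain rfl : i = 0 := by
          by_contra hi
          by_cases hiz' : i = z
          · rw [hiz', hρb hz0] at hiz
            omega
          · have := hρ i hi hiz'
            omega
        by_cases hu0 : u 0 < d
        · obtain ⟨w, hw, hwu⟩ := hsurj (u 0 + 1) hu0
          refine mem_initialExponents_of_le hw.1 fun y => ?_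
          rw [Finsupp.add_apply, Finsupp.tsub_apply]
          by_cases hy0 : y = 0
          · rw [hy0, Finsupp.single_eq_of_ne (Ne.symm hz0), Finsupp.single_eq_same, hwu]
            omega
          by_cases hyz : y = z
          · subst hyz
            rw [Finsupp.single_eq_same]
            by_contra hlt
            have hvw : v = w := by
              refine eq_of_mem_minimalExponents hw hv.1 fun x => ?_
              by_cases hx0 : x = 0
              · have := hvu x
                subst hx0
                omega
              by_cases hxy : x = y
              · have := hvu x
                subst hxy
                omega
              · rw [hb v hv x hx0 hxy]
                exact Nat.zero_le _
            have := hvu 0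
            rw [hvw] at this
            omega
          · rw [hb w hw y hy0 hyz]
            exact Nat.zero_le _
        · refine mem_initialExponents_of_le ha ?_
          rw [Finsupp.single_le_iff, Finsupp.add_apply, Finsupp.tsub_apply, Finsupp.single_eq_same,
            Finsupp.single_eq_of_ne (Ne.symm hz0)]
          omega
      -- Here `z` is neither `x₁` nor `x_b`, so `v` does not involve it and still divides `u` after
      -- a factor `z` is removed.
      · refine mem_initialExponents_of_le hv.1 (le_trans (fun y => ?_) (le_add_of_nonneg_right
          zero_le))
        rw [Finsupp.tsub_apply]
        by_cases hyz : y = z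
        · rw [hyz, hb v hv z hz0 hzb]
          exact Nat.zero_le _
        · rw [Finsupp.single_eq_of_ne hyz]
          exact hvu y

end TwoVariables


/-! ### Conclusion: counting generators in generic coordinates -/

theorem proposition3p2 {K : Type*} [Field K] [CharZero K] (n : ℕ)
    (J G : Ideal (MvPolynomial (Fin n) K))
    (hJ : J.IsHomogeneous (MvPolynomial.homogeneousSubmodule (Fin n) K))
    (hG : IsGenericInitialIdeal J G)
    (hG2 : IsGeneratedInTwoVariables G)
    (S : Finset (MvPolynomial (Fin n) K)) (hS : IsMinimalHomogeneousGenerators J S)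
    (α : ℕ) (hα : IsLeast {d : ℕ | ∃ f ∈ S, f.IsHomogeneous d} α)
    (hcard : (α : ℤ) = (S.card : ℤ) - 1) :
    IsComponentwiseLinear J := by
  classical
  obtain ⟨f, hfS, hfd⟩ := hα.1
  have hfJ : f ∈ J := hS.span_eq ▸ Ideal.subset_span hfS
  obtain ⟨g, hgG, a, ha, had, ha0⟩ :=
    exists_linearChange_single_mem hG hfJ (hS.ne_zero hfS) hfd
  obtain ⟨V, hV, T, hT, hTG⟩ := hG2
  have hS' := hS.image_linearChange g
  have hcard' : (S.image (linearChange g.val)).card = a.degree + 1 := by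
    have hinj : Function.Injective (linearChange g.val) := (linearChangeEquiv g).injective
    rw [Finset.card_image_of_injective S hinj, had]
    omega
  have hsupp : ∀ u ∈ minimalExponents (degRevLex n) (J.map (linearChange g.val)), ∀ i ∉ V,
      u i = 0 := fun u hu i hi =>
    eq_zero_of_mem_minimalExponents hT (hTG.trans hgG.symm) hu hi
  -- The bound `α + 1` on the generators of the initial ideal is the number of generators of `J`, so
  -- both consequences of equality become available: `hlin`, and a set `F` large enough for
  -- stability.
  obtain ⟨hlin, F, hF, hFcard⟩ := leadingExponents_linearMultiples_of_card_le (degRevLex n) hS'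
    fun F hF => hcard' ▸ card_minimalExponents_le hV hsupp ha ha0 F hF
  obtain ⟨ρ, hρ, hst⟩ := exists_stable_ranking hV hsupp ha ha0 hF (hFcard.trans hcard')
  exact (isComponentwiseLinear_of_stable (degRevLex n) hS'.isHomogeneous hlin hρ
    hst).of_map_linearChange
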